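/- **Proposition 4.1.** Let $f\colon\mathbb P^2\dashrightarrow\mathbb P^2$ be the birational map of the complex projective plane $f=(y^2z : x(xz+y^2) : y(xz+y^2))$, with inverse $f^{-1}=(y(z^2-xy) : z(z^2-xy) : xz^2)$. Put $P=(0:0:1)$, $Q=(0:1:0)$, $R=(1:0:0)$, $C=\{xz+y^2=0\}$, $C'=\{z^2-xy=0\}$, $\Delta=\{x=0\}$, $\Delta'=\{y=0\}$, $\Delta''=\{z=0\}$. Let $E,F,G$ denote the exceptional curves obtained by blowing up $R,P,Q$ respectively. In the domain of $f$, there is exactly one point $S$ of $E$ at which $f$ (as a rational map to $\mathbb P^2$) is not regular; let $H$ be the exceptional curve obtained by blowing up $S$. There is exactly one point $U$ of $H$ at which $f$ is not regular; let $L$ be the exceptional curve obtained by blowing up $U$. There is exactly one point $Y$ of $L$ at which $f$ is not regular; let $N$ be the exceptional curve obtained by blowing up $Y$. In the range of $f$, let $T$ be the unique point in which $G$ meets the strict transform of $\Delta$, and let $K$ be the exceptional curve obtained by blowing up $T$. As a map to the plane blown up at $Q,T$, the map $f$ contracts $\Delta'$ to a point $V$ of $K$; let $M$ be the exceptional curve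 obtained by blowing up $V$. As a map to the plane blown up at $Q,T,V$, the map $f$ contracts $\Delta'$ to a point $Z$ of $M$; let $\Omega$ be the exceptional curve obtained by blowing up $Z$. Let $\widehat\xi_1=(R,S,U,Y,P)$ and $\widehat\xi_2=(Q,T,V,Z,R)$, which are ordered lists of (possibly infinitely near) points of $\mathbb P^2$, and let $\mathrm{Bl}_{\widehat\xi_i}\mathbb P^2$ be the surface obtained by successively blowing up the points of $\widehat\xi_i$. Then: 1. $\widehat\xi_1$ and $\widehat\xi_2$ give the minimal desingularizations of $f$ and $f^{-1}$: the map $f$ lifts to a regular map $\mathrm{Bl}_{\widehat\xi_1}\mathbb P^2\to\mathbb P^2$, and every surface obtained from $\mathbb P^2$ by a finite sequence of point blowups on which $f$ becomes regular is obtained from $\mathrm{Bl}_{\widehat\xi_1}\mathbb P^2$ by a finite sequence of point blowups; and the same holds for $f^{-1}$ and $\widehat\xi_2$. 2. $f$ induces an isomorphism $\mathrm{Bl}_{\widehat\xi_1}\mathbb P^2\to\mathrm{Bl}_{\widehat\xi_2}\mathbb P^2$, and this isomorphism maps (the strict transforms of) curves in the first surface onto (the strict transforms of) curves in the second one as follows: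 $$C\to E,\quad F\to C',\quad H\to K,\quad L\to G,\quad E\to M,\quad \Delta'\to\Omega,\quad N\to\Delta''.$$ -/

import Mathlib

open MvPolynomial

noncomputable section

namespace Cremona

/-!
Conventions.  An algebraic surface birational to the complex projective plane is represented, as in
Zariski's theory of models, by the set of the local rings of its (closed) points inside one fixed
field, the surfaces over the plane being identified birationally with the plane.  A point is its
local ring, a rational map is regular at a point when it has an image point whose local ring is
dominated (through pullback of rational functions) by that of the given point, and an isomorphism
is a homeomorphism for the Zariski topologies which respects the local rings.
-/

/-- Homogeneous coordinate ring `ℂ[x, y, z]` of the plane (`x = X 0`, `y = X 1`, `z = X 2`). -/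
abbrev Coord : Type := MvPolynomial (Fin 3) ℂ

/-- The field `ℂ(x, y, z)`; the rational functions on the plane are its elements of degree `0`. -/
abbrev FF : Type := FractionRing Coord

/-! ### The projective plane -/

/-- The ring of all quotients `F / G` of homogeneous polynomials of the same degree
with `G v ≠ 0`. -/
def planeSubring (v : Fin 3 → ℂ) : Subring FF where
  carrier := {a | ∃ (n : ℕ) (F G : Coord), F.IsHomogeneous n ∧ G.IsHomogeneous n ∧
    eval v G ≠ 0 ∧ a = algebraMap Coord FF F / algebraMap Coord FF G}
  zero_mem' := ⟨0, 0, 1, isHomogeneous_zero _ _ _, isHomogeneous_one _ _, by simp, by simp⟩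
  one_mem' := ⟨0, 1, 1, isHomogeneous_one _ _, isHomogeneous_one _ _, by simp, by simp⟩
  neg_mem' := by
    rintro _ ⟨n, F, G, hF, hG, hv, rfl⟩
    exact ⟨n, -F, G, hF.neg, hG, hv, by rw [map_neg]; ring⟩
  mul_mem' := by
    rintro _ _ ⟨n, F, G, hF, hG, hv, rfl⟩ ⟨n', F', G', hF', hG', hv', rfl⟩
    exact ⟨n + n', F * F', G * G', hF.mul hF', hG.mul hG', by simp [hv, hv'],
      by rw [map_mul, map_mul, div_mul_div_comm]⟩
  add_mem' := by
    rintro _ _ ⟨n, F, G, hF, hG, hv, rfl⟩ ⟨n', F', G', hF', hG', hv', rfl⟩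
    have h1 : algebraMap Coord FF G ≠ 0 := by
      intro h
      rw [IsFractionRing.to_map_eq_zero_iff] at h
      exact hv (by simp [h])
    have h2 : algebraMap Coord FF G' ≠ 0 := by
      intro h
      rw [IsFractionRing.to_map_eq_zero_iff] at h
      exact hv' (by simp [h])
    refine ⟨n + n', F * G' + G * F', G * G', (hF.mul hG').add (hG.mul hF'), hG.mul hG',
      by simp [hv, hv'], ?_⟩
    rw [div_add_div _ _ h1 h2, map_add, map_mul, map_mul, map_mul]

theorem isLocalRing_planeSubring (v : Fin 3 → ℂ) : IsLocalRing (planeSubring v) := by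
  refine IsLocalRing.of_isUnit_or_isUnit_one_sub_self ?_
  have key : ∀ (a : planeSubring v) (n : ℕ) (F G : Coord), F.IsHomogeneous n →
      G.IsHomogeneous n → eval v G ≠ 0 → eval v F ≠ 0 →
      (a : FF) = algebraMap Coord FF F / algebraMap Coord FF G → IsUnit a := by
    intro a n F G hF hG hv hu ha
    have h1 : algebraMap Coord FF G ≠ 0 := by
      intro h
      rw [IsFractionRing.to_map_eq_zero_iff] at h
      exact hv (by simp [h])
    have h2 : algebraMap Coord FF F ≠ 0 := by
      intro h
      rw [IsFractionRing.to_map_eq_zero_iff] at h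
      exact hu (by simp [h])
    refine IsUnit.of_mul_eq_one
      ⟨algebraMap Coord FF G / algebraMap Coord FF F, ⟨n, G, F, hG, hF, hu, rfl⟩⟩ ?_
    ext
    simp only [Subring.coe_mul, Subring.coe_one, ha]
    field_simp
  rintro ⟨a, n, F, G, hF, hG, hv, rfl⟩
  by_cases hu : eval v F = 0
  · right
    refine key _ n (G - F) G (hG.sub hF) hG hv (by simpa [hu] using hv) ?_
    have h1 : algebraMap Coord FF G ≠ 0 := by
      intro h
      rw [IsFractionRing.to_map_eq_zero_iff] at h
      exact hv (by simp [h])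
    rw [map_sub, sub_div, div_self h1]
    rfl
  · left
    exact key _ n F G hF hG hv hu rfl

/-- The point of the plane with homogeneous coordinates `v` (meant for `v ≠ 0`),
given by its local ring. -/
def planePoint (v : Fin 3 → ℂ) : LocalSubring FF :=
  @LocalSubring.mk FF _ (planeSubring v) (isLocalRing_planeSubring v)

/-- The projective plane. -/
def plane : Set (LocalSubring FF) := {O | ∃ v : Fin 3 → ℂ, v ≠ 0 ∧ O = planePoint v}

/-- The plane curve with equation `F = 0`. -/
def planeCurve (F : Coord) : Set (LocalSubring FF) :=
  {O | ∃ v : Fin 3 → ℂ, v ≠ 0 ∧ eval v F = 0 ∧ O = planePoint v}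

/-! ### Blowing up points -/

/-- The affine chart ring `A[𝔪/t] = A[{a / t : a ∈ 𝔪}]` of the blow-up of the maximal ideal `𝔪`
of the local ring `A`. -/
def blowUpChart (A : LocalSubring FF) (t : FF) : Subring FF :=
  Subring.closure ((A.toSubring : Set FF) ∪
    {b | ∃ a : A.toSubring, a ∈ IsLocalRing.maximalIdeal A.toSubring ∧ b = (a : FF) / t})

/-- The exceptional curve of the blow-up of the point `A`: its points are the local rings of the
charts `A[𝔪/t]`, for nonzero `t ∈ 𝔪`, at the maximal ideals which contain `𝔪`. -/
def exceptional (A : LocalSubring FF) : Set (LocalSubring FF) :=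
  {B | ∃ t : A.toSubring, t ∈ IsLocalRing.maximalIdeal A.toSubring ∧ t ≠ 0 ∧
    ∃ (𝔫 : Ideal (blowUpChart A t)) (_ : 𝔫.IsMaximal),
      (∀ c : blowUpChart A t, (∃ a ∈ IsLocalRing.maximalIdeal A.toSubring, (a : FF) = c) → c ∈ 𝔫) ∧
      B = LocalSubring.ofPrime (blowUpChart A t) 𝔫}

/-- The blow-up of the surface `S` at its point `A`: the point is replaced by the exceptional
curve, nothing else is changed. -/
def blowUp (S : Set (LocalSubring FF)) (A : LocalSubring FF) : Set (LocalSubring FF) :=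
  (S \ {A}) ∪ exceptional A

/-- The surface obtained from `S` by blowing up successively the points of a list. -/
def Bl (S : Set (LocalSubring FF)) : List (LocalSubring FF) → Set (LocalSubring FF)
  | [] => S
  | A :: l => Bl (blowUp S A) l

/-- The list is an ordered list of possibly infinitely near points of `S`: the first entry is a
point of `S` and each further one is a point of the surface obtained by blowing up all the previous
ones. -/
def IsPointList (S : Set (LocalSubring FF)) : List (LocalSubring FF) → Prop
  | [] => True
  | A :: l => A ∈ S ∧ IsPointList (blowUp S A) l

/-- The Zariski topology: a basis of open sets is given by the sets of all points at which
finitely many given rational functions are regular. -/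
instance zariskiTopology : TopologicalSpace (LocalSubring FF) :=
  TopologicalSpace.generateFrom {U | ∃ h : FF, U = {A | h ∈ A.toSubring}}

/-- Strict transform of a curve `D` of a surface below `S`: the Zariski closure in `S` of
the set of the points of `D` which have not been blown up. (These are the points of `D` in `S`, since
blowing up does not change the other local rings.) -/
def strictTransform (S D : Set (LocalSubring FF)) : Set (LocalSubring FF) :=
  S ∩ closure (D ∩ S)

/-! ### Birational maps -/

/-- Birational self-maps of the plane `v ↦ (F₀ v : F₁ v : F₂ v)`, given by homogeneous polynomials
of the same degree together with such polynomials for the inverse map.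
(A common factor of the three polynomials is harmless, and is not excluded.) -/
structure BirMap where
  /-- The components of the map. -/
  toPoly : Fin 3 → Coord
  /-- The components of the inverse map. -/
  invPoly : Fin 3 → Coord
  /-- The degree of the components of the map. -/
  deg : ℕ
  /-- The degree of the components of the inverse map. -/
  invDeg : ℕ
  toPoly_homogeneous : ∀ i, (toPoly i).IsHomogeneous deg
  invPoly_homogeneous : ∀ i, (invPoly i).IsHomogeneous invDeg
  left_inv : ∃ h : Coord, h ≠ 0 ∧ ∀ i, aeval toPoly (invPoly i) = h * X i
  right_inv : ∃ h : Coord, h ≠ 0 ∧ ∀ i, aeval invPoly (toPoly i) = h * X i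

namespace BirMap

/-- The inverse of a birational map. -/
def symm (f : BirMap) : BirMap where
  toPoly := f.invPoly
  invPoly := f.toPoly
  deg := f.invDeg
  invDeg := f.deg
  toPoly_homogeneous := f.invPoly_homogeneous
  invPoly_homogeneous := f.toPoly_homogeneous
  left_inv := f.right_inv
  right_inv := f.left_inv

theorem aeval_scaled_injective (h : Coord) (hh : h ≠ 0) (p : Coord)
    (hp : aeval (fun i => h * X i) p = 0) : p = 0 := by
  by_contra hp0
  have hom : ∀ (n : ℕ) (q : Coord), q.IsHomogeneous n →
      aeval (fun i => h * X i) q = h ^ n * q := by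
    intro n q hq
    rw [aeval_def, eval₂_eq]
    conv_rhs => rw [q.as_sum, Finset.mul_sum]
    refine Finset.sum_congr rfl fun d hd => ?_
    have hdn : ∑ i ∈ d.support, d i = n := by
      have := hq (mem_support_iff.mp hd)
      rw [← this, Finsupp.weight_apply, Finsupp.sum]
      simp
    rw [monomial_eq, Finsupp.prod]
    simp only [mul_pow, Finset.prod_mul_distrib, Finset.prod_pow_eq_pow_sum, hdn, algebraMap_eq]
    ring
  set N := p.totalDegree with hN
  have hsum : aeval (fun i => h * X i) p
      = ∑ i ∈ Finset.range (N + 1), h ^ i * homogeneousComponent i p := by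
    conv_lhs => rw [← sum_homogeneousComponent p, map_sum]
    exact Finset.sum_congr rfl fun i _ => hom i _ (homogeneousComponent_isHomogeneous i p)
  have htop : homogeneousComponent N p ≠ 0 := by
    intro h0
    have hlt : p.totalDegree < N := by
      conv_lhs => rw [← sum_homogeneousComponent p, Finset.sum_range_succ, ← hN, h0, add_zero]
      rcases Nat.eq_zero_or_pos N with hz | hpos
      · exfalso
        apply hp0
        rw [← sum_homogeneousComponent p, ← hN, Finset.sum_range_succ, h0, hz]
        simp
      · refine lt_of_le_of_lt (totalDegree_finsetSum _ _) ?_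
        rw [Finset.sup_lt_iff (by simpa using hpos)]
        intro i hi
        exact lt_of_le_of_lt (homogeneousComponent_isHomogeneous i p).totalDegree_le
          (Finset.mem_range.mp hi)
    omega
  rw [hp, Finset.sum_range_succ] at hsum
  have hpow : ∀ i : ℕ, (h ^ i).totalDegree = i * h.totalDegree := by
    intro i
    induction i with
    | zero => simp
    | succ i ih =>
      rw [pow_succ, totalDegree_mul_of_isDomain (pow_ne_zero _ hh) hh, ih]
      ring
  have hbot : h ^ N * homogeneousComponent N p
      = -∑ i ∈ Finset.range N, h ^ i * homogeneousComponent i p := by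
    linear_combination -hsum
  have hdeg : (h ^ N * homogeneousComponent N p).totalDegree = N * h.totalDegree + N := by
    rw [totalDegree_mul_of_isDomain (pow_ne_zero _ hh) htop, hpow,
      (homogeneousComponent_isHomogeneous N p).totalDegree htop]
  rcases Nat.eq_zero_or_pos N with hz | hpos
  · rw [hz] at hbot htop
    simp only [pow_zero, one_mul, Finset.range_zero, Finset.sum_empty, neg_zero] at hbot
    exact htop hbot
  · have hlt : (h ^ N * homogeneousComponent N p).totalDegree < N * h.totalDegree + N := by
      rw [hbot, totalDegree_neg]
      refine lt_of_le_of_lt (totalDegree_finsetSum _ _) ?_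
      rw [Finset.sup_lt_iff (by simpa using by omega)]
      intro i hi
      have hi' := Finset.mem_range.mp hi
      refine lt_of_le_of_lt (totalDegree_mul _ _) ?_
      rw [hpow]
      have h1 := (homogeneousComponent_isHomogeneous i p).totalDegree_le
      have h2 : i * h.totalDegree ≤ N * h.totalDegree := Nat.mul_le_mul_right _ hi'.le
      omega
    omega

theorem aeval_toPoly_injective (f : BirMap) :
    Function.Injective (aeval f.toPoly : Coord →ₐ[ℂ] Coord) := by
  rw [injective_iff_map_eq_zero]
  intro p hp
  obtain ⟨h, hh, hi⟩ := f.right_inv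
  refine aeval_scaled_injective h hh p ?_
  have h1 : aeval f.invPoly (aeval f.toPoly p) = 0 := by rw [hp, map_zero]
  have h2 : (aeval f.invPoly).comp (aeval f.toPoly)
      = (aeval (fun i => h * X i) : Coord →ₐ[ℂ] Coord) := by
    refine algHom_ext fun i => ?_
    rw [AlgHom.comp_apply, aeval_X, aeval_X, hi]
  rw [← h2]
  exact h1

/-- Pullback `u ↦ u ∘ f` of rational functions, `(F / G) ↦ F(f₀, f₁, f₂) / G(f₀, f₁, f₂)`. -/
def pullback (f : BirMap) : FF →+* FF :=
  IsFractionRing.map (A := Coord) (B := Coord)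
    (j := ((aeval f.toPoly : Coord →ₐ[ℂ] Coord) : Coord →+* Coord)) f.aeval_toPoly_injective

/-- `f` is regular at the point `A` and maps it to the point `B`: pullback by `f` is a local
homomorphism from the local ring of `B` to that of `A`. -/
def MapsTo (f : BirMap) (A B : LocalSubring FF) : Prop :=
  B.map f.pullback ≤ A

/-- `f`, as a rational map to the surface `T`, is regular at the point `A`. -/
def RegularAt (f : BirMap) (T : Set (LocalSubring FF)) (A : LocalSubring FF) : Prop :=
  ∃ B ∈ T, f.MapsTo A B

/-- Image of the set `D` under the rational map `f` to the surface `T`: the set of the images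
of the points of `D` at which this map is regular. -/
def image (f : BirMap) (T D : Set (LocalSubring FF)) : Set (LocalSubring FF) :=
  {B | B ∈ T ∧ ∃ A ∈ D, f.MapsTo A B}

/-- Blowing up the points of the list `ξ` is the minimal desingularization of
`f : plane ⇢ plane`: after these blow-ups `f` is regular everywhere, and any other sequence of
blow-ups with this property is obtained from this one by further blow-ups. -/
def IsMinimalDesingularization (f : BirMap) (ξ : List (LocalSubring FF)) : Prop :=
  IsPointList plane ξ ∧ (∀ A ∈ Bl plane ξ, f.RegularAt plane A) ∧
  ∀ η : List (LocalSubring FF), IsPointList plane η →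
    (∀ A ∈ Bl plane η, f.RegularAt plane A) →
    ∃ θ : List (LocalSubring FF), IsPointList (Bl plane ξ) θ ∧ Bl (Bl plane ξ) θ = Bl plane η

/-- The homeomorphism `g` is an isomorphism of surfaces which is induced by `f`: for every point `A`
the map `f` is regular at `A` with image `g A`, and pullback by `f` maps the local ring of `g A`
onto that of `A`. -/
def Induces (f : BirMap) {S T : Set (LocalSubring FF)} (g : S ≃ₜ T) : Prop :=
  ∀ A : S, (g A : LocalSubring FF).map f.pullback = A

end BirMap

/-- The homeomorphism `g` maps the curve `C` onto the curve `D`. -/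
def CarriesCurve {S T : Set (LocalSubring FF)} (g : S ≃ₜ T) (C D : Set (LocalSubring FF)) : Prop :=
  ∀ A : S, (A : LocalSubring FF) ∈ C ↔ (g A : LocalSubring FF) ∈ D

/-! ### The cubic map -/

/-- The birational map `f = (y²z : x(xz + y²) : y(xz + y²))`, with inverse
`(y(z² - xy) : z(z² - xy) : xz²)`. -/
def cubicMap : BirMap where
  toPoly := ![X 1 ^ 2 * X 2, X 0 * (X 0 * X 2 + X 1 ^ 2), X 1 * (X 0 * X 2 + X 1 ^ 2)]
  invPoly := ![X 1 * (X 2 ^ 2 - X 0 * X 1), X 2 * (X 2 ^ 2 - X 0 * X 1), X 0 * X 2 ^ 2]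
  deg := 3
  invDeg := 3
  toPoly_homogeneous := by
    have h (i : Fin 3) : (X i : Coord).IsHomogeneous 1 := isHomogeneous_X _ _
    have hC : (X 0 * X 2 + X 1 ^ 2 : Coord).IsHomogeneous 2 := ((h 0).mul (h 2)).add ((h 1).pow 2)
    intro i
    fin_cases i
    · exact ((h 1).pow 2).mul (h 2)
    · exact (h 0).mul hC
    · exact (h 1).mul hC
  invPoly_homogeneous := by
    have h (i : Fin 3) : (X i : Coord).IsHomogeneous 1 := isHomogeneous_X _ _
    have hC : (X 2 ^ 2 - X 0 * X 1 : Coord).IsHomogeneous 2 := ((h 2).pow 2).sub ((h 0).mul (h 1))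
    intro i
    fin_cases i
    · exact (h 1).mul hC
    · exact (h 2).mul hC
    · exact (h 0).mul ((h 2).pow 2)
  left_inv := by
    refine ⟨X 1 ^ 4 * (X 0 * X 2 + X 1 ^ 2) ^ 2, ?_, ?_⟩
    · intro h
      simpa using congrArg (eval ![0, 1, 0]) h
    · intro i
      fin_cases i <;> simp <;> ring
  right_inv := by
    refine ⟨X 2 ^ 4 * (X 2 ^ 2 - X 0 * X 1) ^ 2, ?_, ?_⟩
    · intro h
      simpa using congrArg (eval ![0, 0, 1]) h
    · intro i
      fin_cases i <;> simp <;> ring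

/-- `P = (0 : 0 : 1)` -/
def pointP : LocalSubring FF := planePoint ![0, 0, 1]

/-- `Q = (0 : 1 : 0)` -/
def pointQ : LocalSubring FF := planePoint ![0, 1, 0]

/-- `R = (1 : 0 : 0)` -/
def pointR : LocalSubring FF := planePoint ![1, 0, 0]

/-- The conic `C : xz + y² = 0`. -/
def conicC : Set (LocalSubring FF) := planeCurve (X 0 * X 2 + X 1 ^ 2)

/-- The conic `C' : z² - xy = 0`. -/
def conicC' : Set (LocalSubring FF) := planeCurve (X 2 ^ 2 - X 0 * X 1)

/-- The line `Δ : x = 0`. -/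
def lineΔ : Set (LocalSubring FF) := planeCurve (X 0)

/-- The line `Δ' : y = 0`. -/
def lineΔ' : Set (LocalSubring FF) := planeCurve (X 1)

/-- The line `Δ'' : z = 0`. -/
def lineΔ'' : Set (LocalSubring FF) := planeCurve (X 2)

end Cremona

end

noncomputable section

/-! Write `f = L ∘ σ`, where `L (x : y : z) = (-z : x : y)` is linear and `σ = (x(xz+y²) : y(xz+y²)
: -y²z)`. In the coordinates `y/x` and `w = (xz+y²)/x²` (written `y`, `w` below) the map `σ` is `(y,
w) ↦ (y, y⁴/w)`, an involution (`invol_cy`, `invol_cw`). Since `L` carries the points `R, S, U, Y,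
P` to `Q, T, V, Z, R`, all the claims about `f` and `f⁻¹` reduce to claims about `σ` on the single
surface `resolved`.

The point `tower n` is the point of order `n` on the conic `w = 0` infinitely near to `R`. Its
exceptional curve has the coordinate `w/yⁿ⁺¹`, and the line `y = 0` has the coordinate `w`. The
involution sends `w/yⁿ` to the inverse of `w/y⁴⁻ⁿ`, so it reverses the chain formed by the line `y =
0` and the exceptional curves of `tower 0`, ..., `tower 3`. It also exchanges the conic with the
exceptional curve of `P`. Checking this family by family (`exists_map_invol_le`) shows that `σ`
lifts to a regular map of `resolved`; being an involution on a separated surface, the lift is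
biregular (`map_invol_eq_of_le`).

At each blown up point `σ` is not regular: a whole curve of points dominating it has distinct
images, which a regular image would have to equal (`not_map_invol_le_tower`,
`not_map_invol_le_pointP`). Minimality is then formal. A surface on which `f` is regular contains
none of these points, so each of them was blown up on the way, and blow-ups at distinct points
commute (`exists_list_of_forall_notMem`).

The computations rest on three facts. `loc u v` is the least local ring in which `u` and `v` vanish
(`loc_le`), so domination is checked by evaluating two functions. The exceptional curve of `loc u v`
is the projective line with coordinate `v/u` (`AI.mem_exceptional_iff`). All but finitely many
points of such a line lie in any given neighbourhood of each of its points (`AI.tendsto_loc`), so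
the images of curves need only be computed at general points. -/

namespace Cremona

/-! ### Values of rational functions at local rings -/

section Values

variable {K : Type*} [Field K]

/-- The element `a` lies in the maximal ideal of the local ring `A`. -/
def InMax (A : LocalSubring K) (a : K) : Prop :=
  a ∈ A.toSubring ∧ (a ≠ 0 → a⁻¹ ∉ A.toSubring)

theorem inMax_coe_iff {A : LocalSubring K} (a : A.toSubring) :
    InMax A (a : K) ↔ a ∈ IsLocalRing.maximalIdeal A.toSubring := by
  rw [IsLocalRing.mem_maximalIdeal, mem_nonunits_iff]
  constructor
  · rintro ⟨-, h⟩ hu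
    obtain ⟨b, hb⟩ := hu.exists_right_inv
    have hb' : (a : K) * b = 1 := by simpa using congrArg Subtype.val hb
    have ha : (a : K) ≠ 0 := left_ne_zero_of_mul_eq_one hb'
    refine h ha ?_
    rw [inv_eq_of_mul_eq_one_right hb']
    exact b.2
  · intro h
    refine ⟨a.2, fun ha hi => h ?_⟩
    exact IsUnit.of_mul_eq_one ⟨_, hi⟩ (Subtype.ext (by simp [ha]))

theorem inMax_iff {A : LocalSubring K} {a : K} :
    InMax A a ↔ ∃ h : a ∈ A.toSubring, (⟨a, h⟩ : A.toSubring) ∈ IsLocalRing.maximalIdeal _ :=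
  ⟨fun h => ⟨h.1, (inMax_coe_iff ⟨a, h.1⟩).1 h⟩, fun ⟨h, h'⟩ => (inMax_coe_iff ⟨a, h⟩).2 h'⟩

theorem InMax.mem {A : LocalSubring K} {a : K} (h : InMax A a) : a ∈ A.toSubring := h.1

theorem inMax_zero (A : LocalSubring K) : InMax A 0 := ⟨zero_mem _, fun h => absurd rfl h⟩

theorem InMax.add {A : LocalSubring K} {a b : K} (ha : InMax A a) (hb : InMax A b) :
    InMax A (a + b) := by
  obtain ⟨h1, h2⟩ := inMax_iff.1 ha
  obtain ⟨h3, h4⟩ := inMax_iff.1 hb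
  exact (inMax_coe_iff (⟨a, h1⟩ + ⟨b, h3⟩ : A.toSubring)).2 (Ideal.add_mem _ h2 h4)

theorem InMax.mul_left {A : LocalSubring K} {a b : K} (ha : a ∈ A.toSubring) (hb : InMax A b) :
    InMax A (a * b) := by
  obtain ⟨h3, h4⟩ := inMax_iff.1 hb
  exact (inMax_coe_iff (⟨a, ha⟩ * ⟨b, h3⟩ : A.toSubring)).2 (Ideal.mul_mem_left _ _ h4)

theorem InMax.neg {A : LocalSubring K} {a : K} (ha : InMax A a) : InMax A (-a) := by
  have := InMax.mul_left (A := A) (neg_mem (one_mem _)) ha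
  simpa using this

theorem InMax.sub {A : LocalSubring K} {a b : K} (ha : InMax A a) (hb : InMax A b) :
    InMax A (a - b) := by
  rw [sub_eq_add_neg]
  exact ha.add hb.neg

theorem not_inMax_one (A : LocalSubring K) : ¬ InMax A 1 := fun h =>
  h.2 one_ne_zero (by rw [inv_one]; exact one_mem _)

/-- Domination in terms of elements of the field alone, which avoids coercions between subrings; all
later comparisons of points use this form. -/
theorem le_iff_inMax {A B : LocalSubring K} :
    A ≤ B ↔ A.toSubring ≤ B.toSubring ∧ ∀ a, InMax A a → InMax B a := by
  constructor
  · rintro ⟨h, hl⟩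
    refine ⟨h, fun a ha => ⟨h ha.1, fun h0 hi => ha.2 h0 ?_⟩⟩
    have hu : IsUnit (Subring.inclusion h ⟨a, ha.1⟩) :=
      IsUnit.of_mul_eq_one ⟨_, hi⟩ (Subtype.ext (by simp [h0]))
    by_contra hn
    exact (inMax_coe_iff (⟨a, ha.1⟩ : A.toSubring)).1 ha (hl.map_nonunit _ hu)
  · rintro ⟨h, hm⟩
    refine ⟨h, ⟨fun a hu => ?_⟩⟩
    by_contra hn
    exact (inMax_coe_iff (Subring.inclusion h a)).1 (hm a ((inMax_coe_iff a).2 hn)) hu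

theorem InMax.mono {A B : LocalSubring K} (h : A ≤ B) {a : K} (ha : InMax A a) : InMax B a :=
  (le_iff_inMax.1 h).2 a ha

/-- An element of a local ring which becomes a unit in a dominating one is a unit. -/
theorem inv_mem_of_le {A B : LocalSubring K} (h : A ≤ B) {a : K} (ha : a ∈ A.toSubring)
    (ha0 : a ≠ 0) (hi : a⁻¹ ∈ B.toSubring) : a⁻¹ ∈ A.toSubring := by
  by_contra hn
  exact (InMax.mono h ⟨ha, fun _ => hn⟩).2 ha0 hi

theorem mem_map_iff {L : Type*} [Field L] {A : LocalSubring K} {a : K} (φ : K →+* L) :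
    φ a ∈ (A.map φ).toSubring ↔ a ∈ A.toSubring := by
  rw [LocalSubring.map_toSubring, Subring.mem_map]
  exact ⟨fun ⟨b, hb, h⟩ => φ.injective h ▸ hb, fun h => ⟨a, h, rfl⟩⟩

theorem inMax_map_iff {L : Type*} [Field L] {A : LocalSubring K} {a : K} (φ : K →+* L) :
    InMax (A.map φ) (φ a) ↔ InMax A a := by
  rw [InMax, InMax, ← map_inv₀, mem_map_iff, mem_map_iff, map_ne_zero]

/-- The local ring contains the constants. -/
def HasConst [Algebra ℂ K] (A : LocalSubring K) : Prop :=
  ∀ c : ℂ, algebraMap ℂ K c ∈ A.toSubring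

/-- The function `a` is regular at the point `A`, with value `c`. -/
def HasVal [Algebra ℂ K] (A : LocalSubring K) (a : K) (c : ℂ) : Prop :=
  HasConst A ∧ InMax A (a - algebraMap ℂ K c)

variable [Algebra ℂ K] {A B : LocalSubring K} {a b : K} {c d : ℂ}

theorem HasVal.mem (h : HasVal A a c) : a ∈ A.toSubring := by
  have := add_mem h.2.1 (h.1 c)
  simpa using this

theorem HasVal.inMax (h : HasVal A a 0) : InMax A a := by simpa using h.2

theorem InMax.hasVal (hA : HasConst A) (h : InMax A a) : HasVal A a 0 := ⟨hA, by simpa using h⟩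

theorem HasConst.mono (h : A ≤ B) (hA : HasConst A) : HasConst B := fun c => h.1 (hA c)

theorem HasVal.mono (h : A ≤ B) (ha : HasVal A a c) : HasVal B a c :=
  ⟨ha.1.mono h, ha.2.mono h⟩

theorem HasConst.val (hA : HasConst A) (c : ℂ) : HasVal A (algebraMap ℂ K c) c :=
  ⟨hA, by simpa using inMax_zero A⟩

theorem HasConst.one (hA : HasConst A) : HasVal A (1 : K) 1 := by simpa using hA.val 1

theorem HasVal.add (ha : HasVal A a c) (hb : HasVal A b d) : HasVal A (a + b) (c + d) := by
  refine ⟨ha.1, ?_⟩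
  have := ha.2.add hb.2
  rwa [show a + b - algebraMap ℂ K (c + d)
    = (a - algebraMap ℂ K c) + (b - algebraMap ℂ K d) by rw [map_add]; ring]

theorem HasVal.neg (ha : HasVal A a c) : HasVal A (-a) (-c) := by
  refine ⟨ha.1, ?_⟩
  have := ha.2.neg
  rwa [show -a - algebraMap ℂ K (-c) = -(a - algebraMap ℂ K c) by rw [map_neg]; ring]

theorem HasVal.sub (ha : HasVal A a c) (hb : HasVal A b d) : HasVal A (a - b) (c - d) := by
  rw [sub_eq_add_neg, sub_eq_add_neg]
  exact ha.add hb.neg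

theorem HasVal.mul (ha : HasVal A a c) (hb : HasVal A b d) : HasVal A (a * b) (c * d) := by
  refine ⟨ha.1, ?_⟩
  have := (hb.2.mul_left ha.mem).add (ha.2.mul_left (ha.1 d))
  rwa [show a * b - algebraMap ℂ K (c * d) = a * (b - algebraMap ℂ K d)
    + algebraMap ℂ K d * (a - algebraMap ℂ K c) by rw [map_mul]; ring]

theorem HasVal.pow (ha : HasVal A a c) (n : ℕ) : HasVal A (a ^ n) (c ^ n) := by
  induction n with
  | zero => simpa using ha.1.one
  | succ n ih => rw [pow_succ, pow_succ]; exact ih.mul ha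

/-- The difference of the two values would be a nonzero constant in the maximal ideal, but constants
are units. Most separation arguments below end in this contradiction. -/
theorem HasVal.unique (ha : HasVal A a c) (hb : HasVal A a d) : c = d := by
  have h : HasVal A (algebraMap ℂ K (c - d)) 0 := by
    have := ((ha.1.val c).sub ha).add (hb.sub (ha.1.val d))
    simp only [sub_self, add_zero] at this
    rwa [show algebraMap ℂ K (c - d) = algebraMap ℂ K c - a + (a - algebraMap ℂ K d) by
      rw [map_sub]; ring]
  by_contra hn
  have h0 : c - d ≠ 0 := sub_ne_zero.2 hn
  refine h.inMax.2 ((map_ne_zero _).2 h0) ?_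
  rw [← map_inv₀]
  exact ha.1 _

theorem HasVal.ne_zero (ha : HasVal A a c) (hc : c ≠ 0) : a ≠ 0 := by
  rintro rfl
  exact hc (ha.unique (by simpa using ha.1.val 0))

theorem HasVal.inv (ha : HasVal A a c) (hc : c ≠ 0) : HasVal A a⁻¹ c⁻¹ := by
  have ha0 := ha.ne_zero hc
  have hi : a⁻¹ ∈ A.toSubring := by
    by_contra hn
    exact hc (ha.unique (InMax.hasVal ha.1 ⟨ha.mem, fun _ => hn⟩))
  refine ⟨ha.1, ?_⟩
  have := InMax.mul_left (mul_mem hi (ha.1 c⁻¹)) ha.2.neg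
  have hc' : algebraMap ℂ K c ≠ 0 := by simpa using hc
  rwa [show a⁻¹ - algebraMap ℂ K c⁻¹ = a⁻¹ * algebraMap ℂ K c⁻¹ * -(a - algebraMap ℂ K c) by
    rw [map_inv₀]; field_simp; ring]

theorem HasVal.div (ha : HasVal A a c) (hb : HasVal A b d) (hd : d ≠ 0) :
    HasVal A (a / b) (c / d) := by
  rw [div_eq_mul_inv, div_eq_mul_inv]
  exact ha.mul (hb.inv hd)

theorem HasVal.congr (ha : HasVal A a c) (hab : b = a) (hcd : d = c) : HasVal A b d := by
  subst hab hcd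
  exact ha

theorem HasVal.sub_const (ha : HasVal A a c) : HasVal A (a - algebraMap ℂ K c) 0 := by
  simpa using ha.sub (ha.1.val c)

theorem HasVal.of_sub (ha : HasVal A (a - algebraMap ℂ K c) 0) : HasVal A a c := by
  simpa using ha.add (ha.1.val c)

theorem HasVal.aeval {σ : Type*} {g : σ → K} {x : σ → ℂ} (hA : HasConst A)
    (h : ∀ i, HasVal A (g i) (x i)) (p : MvPolynomial σ ℂ) :
    HasVal A (aeval g p) (eval x p) := by
  induction p using MvPolynomial.induction_on with
  | C c => simpa using hA.val c
  | add p q hp hq => simpa using hp.add hq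
  | mul_X p i hp => simpa using hp.mul (h i)

end Values

/-! ### The local ring of a plane at the origin of a coordinate system -/

section Loc

variable {K : Type*} [Field K] [Algebra ℂ K]

/-- The ring of quotients `p(u, v) / q(u, v)` of polynomials with `q(0, 0) ≠ 0`. -/
def locSubring (u v : K) : Subring K where
  -- The condition `aeval ![u, v] q ≠ 0` makes this a subring for arbitrary `u`, `v`; it is
  -- automatic when they are algebraically independent.
  carrier := {a | ∃ p q : MvPolynomial (Fin 2) ℂ, eval 0 q ≠ 0 ∧ aeval ![u, v] q ≠ 0 ∧
    a = aeval ![u, v] p / aeval ![u, v] q}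
  zero_mem' := ⟨0, 1, by simp, by simp, by simp⟩
  one_mem' := ⟨1, 1, by simp, by simp, by simp⟩
  neg_mem' := by
    rintro _ ⟨p, q, h0, h1, rfl⟩
    exact ⟨-p, q, h0, h1, by rw [map_neg]; ring⟩
  mul_mem' := by
    rintro _ _ ⟨p, q, h0, h1, rfl⟩ ⟨p', q', h0', h1', rfl⟩
    exact ⟨p * p', q * q', by rw [map_mul]; exact mul_ne_zero h0 h0',
      by rw [map_mul]; exact mul_ne_zero h1 h1', by rw [map_mul, map_mul, div_mul_div_comm]⟩
  add_mem' := by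
    rintro _ _ ⟨p, q, h0, h1, rfl⟩ ⟨p', q', h0', h1', rfl⟩
    exact ⟨p * q' + q * p', q * q', by rw [map_mul]; exact mul_ne_zero h0 h0',
      by rw [map_mul]; exact mul_ne_zero h1 h1',
      by rw [div_add_div _ _ h1 h1']; simp only [map_add, map_mul]⟩

theorem inv_mem_locSubring {u v : K} {p q : MvPolynomial (Fin 2) ℂ} (hp : eval 0 p ≠ 0) :
    (aeval ![u, v] p / aeval ![u, v] q)⁻¹ ∈ locSubring u v := by
  by_cases h : aeval ![u, v] p = 0
  · rw [h, zero_div, inv_zero]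
    exact zero_mem _
  · exact ⟨q, p, hp, h, by rw [inv_div]⟩

theorem isLocalRing_locSubring (u v : K) : IsLocalRing (locSubring u v) := by
  have key : ∀ a : locSubring u v, (a : K) ≠ 0 → (a : K)⁻¹ ∈ locSubring u v → IsUnit a :=
    fun a h0 h => IsUnit.of_mul_eq_one ⟨_, h⟩ (Subtype.ext (by simp [h0]))
  refine IsLocalRing.of_isUnit_or_isUnit_one_sub_self ?_
  rintro ⟨a, p, q, h0, h1, rfl⟩
  by_cases ha0 : aeval ![u, v] p = 0
  · right
    convert isUnit_one
    ext
    simp [ha0]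
  by_cases ha1 : aeval ![u, v] q = aeval ![u, v] p
  · left
    convert isUnit_one
    ext
    simp [← ha1, div_self h1]
  have hs : 1 - aeval ![u, v] p / aeval ![u, v] q = aeval ![u, v] (q - p) / aeval ![u, v] q := by
    rw [map_sub, sub_div, div_self h1]
  by_cases hp : eval 0 p = 0
  · right
    refine key _ ?_ ?_
    · change 1 - aeval ![u, v] p / aeval ![u, v] q ≠ 0
      rw [hs]
      exact div_ne_zero (by rw [map_sub]; exact sub_ne_zero.2 ha1) h1
    · change (1 - aeval ![u, v] p / aeval ![u, v] q)⁻¹ ∈ _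
      rw [hs]
      exact inv_mem_locSubring (by rw [map_sub, hp, sub_zero]; exact h0)
  · left
    exact key _ (div_ne_zero ha0 h1) (inv_mem_locSubring hp)

/-- The local ring at the origin of the plane with coordinates `u`, `v`. -/
def loc (u v : K) : LocalSubring K :=
  @LocalSubring.mk K _ (locSubring u v) (isLocalRing_locSubring u v)

theorem aeval_mem_loc (u v : K) (p : MvPolynomial (Fin 2) ℂ) :
    aeval ![u, v] p ∈ (loc u v).toSubring := ⟨p, 1, by simp, by simp, by simp⟩

theorem hasConst_loc (u v : K) : HasConst (loc u v) := fun c => by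
  simpa using aeval_mem_loc u v (C c)

/-- Universal property of the origin: a polynomial in `u`, `v` has in `A` its value at `0`, so the
admissible denominators become units of `A`. -/
theorem loc_le {u v : K} {A : LocalSubring K} (hu : HasVal A u 0) (hv : HasVal A v 0) :
    loc u v ≤ A := by
  have hval : ∀ p : MvPolynomial (Fin 2) ℂ, HasVal A (aeval ![u, v] p) (eval 0 p) := fun p =>
    HasVal.aeval hu.1 (fun i => by fin_cases i; exacts [hu, hv]) p
  refine le_iff_inMax.2 ⟨?_, ?_⟩
  · rintro _ ⟨p, q, h0, h1, rfl⟩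
    exact ((hval p).div (hval q) h0).mem
  · rintro a ⟨⟨p, q, h0, h1, rfl⟩, hi⟩
    by_cases hp : eval 0 p = 0
    · have := (hval p).div (hval q) h0
      rw [hp, zero_div] at this
      exact this.inMax
    · by_cases hz : aeval ![u, v] p / aeval ![u, v] q = 0
      · rw [hz]
        exact inMax_zero A
      · exact absurd (inv_mem_locSubring hp) (hi hz)

/-- Algebraic independence of two elements. -/
abbrev AI (u v : K) : Prop := AlgebraicIndependent ℂ ![u, v]

/-- If `p - p(0)` had the inverse `p'/q'` in the local ring, independence would give the polynomial
identity `q' = (p - p(0)) p'`, which contradicts `q'(0) ≠ 0`. -/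
theorem AI.hasVal_aeval {u v : K} (h : AI u v) (p : MvPolynomial (Fin 2) ℂ) :
    HasVal (loc u v) (aeval ![u, v] p) (eval 0 p) := by
  refine ⟨hasConst_loc u v, ?_⟩
  have he : aeval ![u, v] p - algebraMap ℂ K (eval 0 p) = aeval ![u, v] (p - C (eval 0 p)) := by
    simp
  rw [he]
  refine ⟨aeval_mem_loc _ _ _, ?_⟩
  rintro h0 ⟨p', q', h1, h2, h3⟩
  have h4 : aeval ![u, v] (q' - (p - C (eval 0 p)) * p') = 0 := by
    rw [map_sub, map_mul]
    field_simp at h3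
    rw [h3]
    ring
  have h5 := h.eq_zero_of_aeval_eq_zero _ h4
  have h6 := congrArg (eval 0) h5
  simp at h6
  exact h1 (by simpa using h6)

theorem AI.hasVal_left {u v : K} (h : AI u v) : HasVal (loc u v) u 0 := by
  simpa using h.hasVal_aeval (X 0)

theorem AI.hasVal_right {u v : K} (h : AI u v) : HasVal (loc u v) v 0 := by
  simpa using h.hasVal_aeval (X 1)

theorem AI.loc_le_iff {u v : K} (h : AI u v) {A : LocalSubring K} :
    loc u v ≤ A ↔ HasVal A u 0 ∧ HasVal A v 0 :=
  ⟨fun hA => ⟨h.hasVal_left.mono hA, h.hasVal_right.mono hA⟩, fun hA => loc_le hA.1 hA.2⟩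

theorem AI.exists_hasVal {u v a : K} (h : AI u v) (ha : a ∈ (loc u v).toSubring) :
    ∃ c, HasVal (loc u v) a c := by
  obtain ⟨p, q, h0, h1, rfl⟩ := ha
  exact ⟨_, (h.hasVal_aeval p).div (h.hasVal_aeval q) h0⟩

theorem AI.left_ne_zero {u v : K} (h : AI u v) : u ≠ 0 := by simpa using h.ne_zero 0

theorem AI.right_ne_zero {u v : K} (h : AI u v) : v ≠ 0 := by simpa using h.ne_zero 1

theorem loc_comm (u v : K) : loc u v = loc v u := by
  have key : ∀ u v : K, locSubring u v ≤ locSubring v u := by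
    rintro u v _ ⟨p, q, h0, h1, rfl⟩
    have hr : ∀ p : MvPolynomial (Fin 2) ℂ,
        aeval ![v, u] (rename (Equiv.swap 0 1) p) = aeval ![u, v] p := fun p => by
      rw [aeval_rename]
      congr 2
      ext i
      fin_cases i <;> simp
    refine ⟨rename (Equiv.swap 0 1) p, rename (Equiv.swap 0 1) q, ?_, ?_, ?_⟩
    · rw [eval_rename]
      exact h0
    · rwa [hr]
    · rw [hr, hr]
  exact LocalSubring.ext (le_antisymm (key u v) (key v u))

theorem loc_eq {u v u' v' : K} (h1 : HasVal (loc u v) u' 0) (h2 : HasVal (loc u v) v' 0)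
    (h3 : HasVal (loc u' v') u 0) (h4 : HasVal (loc u' v') v 0) : loc u v = loc u' v' :=
  le_antisymm (loc_le h3 h4) (loc_le h1 h2)

theorem map_aeval_of_const {L : Type*} [Field L] [Algebra ℂ L] (φ : K →+* L)
    (hφ : ∀ c, φ (algebraMap ℂ K c) = algebraMap ℂ L c) (u v : K)
    (p : MvPolynomial (Fin 2) ℂ) : φ (aeval ![u, v] p) = aeval ![φ u, φ v] p := by
  induction p using MvPolynomial.induction_on with
  | C c => simp [hφ]
  | add p q hp hq => simp [hp, hq]
  | mul_X p i hp =>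
    rw [map_mul, map_mul, hp, map_mul, aeval_X, aeval_X]
    fin_cases i <;> rfl

/-- A field map which fixes the constants commutes with substitution into polynomials, so the
transform of a point is computed on its two coordinates. -/
theorem loc_map {L : Type*} [Field L] [Algebra ℂ L] (φ : K →+* L)
    (hφ : ∀ c, φ (algebraMap ℂ K c) = algebraMap ℂ L c) (u v : K) :
    (loc u v).map φ = loc (φ u) (φ v) := by
  refine LocalSubring.ext ?_
  ext a
  rw [LocalSubring.map_toSubring, Subring.mem_map]
  constructor
  · rintro ⟨_, ⟨p, q, h0, h1, rfl⟩, rfl⟩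
    refine ⟨p, q, h0, ?_, ?_⟩
    · rw [← map_aeval_of_const φ hφ]
      exact (map_ne_zero φ).2 h1
    · rw [map_div₀, map_aeval_of_const φ hφ, map_aeval_of_const φ hφ]
  · rintro ⟨p, q, h0, h1, rfl⟩
    refine ⟨_, ⟨p, q, h0, ?_, rfl⟩, ?_⟩
    · rw [← map_aeval_of_const φ hφ] at h1
      exact (map_ne_zero φ).1 h1
    · rw [map_div₀, map_aeval_of_const φ hφ, map_aeval_of_const φ hφ]

/-- Elements which generate a field containing as many algebraically independent elements are
algebraically independent. -/
theorem algebraicIndependent_of_mem_adjoin {ι : Type} [Finite ι] {x x' : ι → K}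
    (hx : AlgebraicIndependent ℂ x)
    (h : ∀ i, x i ∈ IntermediateField.adjoin ℂ (Set.range x')) : AlgebraicIndependent ℂ x' := by
  set E := IntermediateField.adjoin ℂ (Set.range x') with hE
  let y : ι → E := fun i => ⟨x i, h i⟩
  let y' : ι → E := fun i => ⟨x' i, IntermediateField.subset_adjoin ℂ _ ⟨i, rfl⟩⟩
  have hy : AlgebraicIndependent ℂ y := AlgebraicIndependent.of_comp E.val hx
  have htop : IntermediateField.adjoin ℂ (Set.range y') = ⊤ := by
    have := IntermediateField.lift_adjoin ℂ E (Set.range y')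
    apply IntermediateField.lift_injective E
    rw [this, IntermediateField.lift_top, ← Set.range_comp]
    rfl
  have halg : Algebra.IsAlgebraic (Algebra.adjoin ℂ (Set.range y')) E := by
    refine ⟨fun a => ?_⟩
    have ha : a ∈ IntermediateField.adjoin ℂ (Set.range y') := by rw [htop]; trivial
    rw [IntermediateField.mem_adjoin_iff_div] at ha
    obtain ⟨r, hr, s, hs, rfl⟩ := ha
    have e1 : IsAlgebraic (Algebra.adjoin ℂ (Set.range y')) r :=
      isAlgebraic_algebraMap (⟨r, hr⟩ : Algebra.adjoin ℂ (Set.range y'))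
    have e2 : IsAlgebraic (Algebra.adjoin ℂ (Set.range y')) s :=
      isAlgebraic_algebraMap (⟨s, hs⟩ : Algebra.adjoin ℂ (Set.range y'))
    rw [div_eq_mul_inv]
    exact e1.mul e2.inv
  -- The independent family `y` bounds the number of indices by the transcendence degree of `E`. As
  -- `E` is algebraic over the equally many `y'`, these form a transcendence basis.
  have hle := hy.lift_cardinalMk_le_trdeg
  have := (Algebra.IsAlgebraic.isTranscendenceBasis_of_lift_le_trdeg_of_finite ℂ y'
    hle).1
  exact this.map' (f := E.val) E.val.injective

/-- The hypotheses quantify over all intermediate fields, so that a change of coordinates is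
verified just by field operations inside `E`. -/
theorem AI.of_mem_adjoin {u v u' v' : K} (h : AI u v)
    (hu : ∀ E : IntermediateField ℂ K, u' ∈ E → v' ∈ E → u ∈ E)
    (hv : ∀ E : IntermediateField ℂ K, u' ∈ E → v' ∈ E → v ∈ E) : AI u' v' := by
  have h1 : u' ∈ IntermediateField.adjoin ℂ (Set.range ![u', v']) :=
    IntermediateField.subset_adjoin ℂ _ ⟨0, rfl⟩
  have h2 : v' ∈ IntermediateField.adjoin ℂ (Set.range ![u', v']) :=
    IntermediateField.subset_adjoin ℂ _ ⟨1, rfl⟩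
  refine algebraicIndependent_of_mem_adjoin h fun i => ?_
  fin_cases i
  exacts [hu _ h1 h2, hv _ h1 h2]

theorem AI.symm {u v : K} (h : AI u v) : AI v u :=
  h.of_mem_adjoin (fun _ _ h2 => h2) (fun _ h1 _ => h1)

theorem AI.div_sub {u v : K} (h : AI u v) (c : ℂ) : AI u (v / u - algebraMap ℂ K c) := by
  refine h.of_mem_adjoin (fun _ h1 _ => h1) fun E h1 h2 => ?_
  have := E.mul_mem (E.add_mem h2 (E.algebraMap_mem c)) h1
  rwa [sub_add_cancel, div_mul_cancel₀ _ h.left_ne_zero] at this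

theorem AI.div {u v : K} (h : AI u v) : AI u (v / u) := by
  simpa using h.div_sub 0

theorem AI.sub_const {u v : K} (h : AI u v) (a b : ℂ) :
    AI (u - algebraMap ℂ K a) (v - algebraMap ℂ K b) := by
  refine h.of_mem_adjoin (fun E h1 h2 => ?_) fun E h1 h2 => ?_
  · simpa using E.add_mem h1 (E.algebraMap_mem a)
  · simpa using E.add_mem h2 (E.algebraMap_mem b)

end Loc

/-! ### The exceptional curve of a point with given local coordinates -/

section OfPrime

variable {K : Type*} [Field K]

theorem mem_ofPrime {A : Subring K} {P : Ideal A} [P.IsPrime] {a : K} :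
    a ∈ (LocalSubring.ofPrime A P).toSubring ↔
      ∃ b c : A, c ∉ P ∧ a = (b : K) / c := by
  constructor
  · intro ha
    obtain ⟨b, c, hbc⟩ := IsLocalization.exists_mk'_eq P.primeCompl
      (⟨a, ha⟩ : (LocalSubring.ofPrime A P).toSubring)
    refine ⟨b, c, c.2, ?_⟩
    have h1 := IsLocalization.mk'_spec (LocalSubring.ofPrime A P).toSubring b c
    rw [hbc] at h1
    have h2 : a * ((c : A) : K) = b := congrArg Subtype.val h1
    have hc0 : ((c : A) : K) ≠ 0 := fun h => c.2 (by
      rw [show (c : A) = 0 from Subtype.ext h]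
      exact zero_mem P)
    rw [← h2, mul_div_cancel_right₀ _ hc0]
  · rintro ⟨b, c, hc, rfl⟩
    have hu := IsLocalization.map_units (LocalSubring.ofPrime A P).toSubring
      (⟨c, hc⟩ : P.primeCompl)
    obtain ⟨d, hd⟩ := hu.exists_right_inv
    have hd' : (c : K) * d = 1 := congrArg Subtype.val hd
    rw [div_eq_mul_inv, inv_eq_of_mul_eq_one_right hd']
    exact mul_mem (LocalSubring.le_ofPrime A P b.2) d.2

theorem inMax_ofPrime {A : Subring K} {P : Ideal A} [P.IsPrime] (a : A) :
    InMax (LocalSubring.ofPrime A P) (a : K) ↔ a ∈ P := by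
  have h := IsLocalization.AtPrime.to_map_mem_maximal_iff (LocalSubring.ofPrime A P).toSubring P a
    (LocalSubring.isLocalRing _)
  rw [← h, ← inMax_coe_iff]
  rfl

theorem ofPrime_le {A : Subring K} {P : Ideal A} [P.IsPrime] {D : LocalSubring K}
    (hA : A ≤ D.toSubring) (hP : ∀ a : A, a ∈ P ↔ InMax D (a : K)) :
    LocalSubring.ofPrime A P ≤ D := by
  have hinv : ∀ c : A, c ∉ P → (c : K)⁻¹ ∈ D.toSubring := fun c hc => by
    by_contra hn
    exact hc ((hP c).2 ⟨hA c.2, fun _ => hn⟩)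
  refine le_iff_inMax.2 ⟨fun a ha => ?_, fun a ha => ?_⟩
  · obtain ⟨b, c, hc, rfl⟩ := mem_ofPrime.1 ha
    rw [div_eq_mul_inv]
    exact mul_mem (hA b.2) (hinv c hc)
  · obtain ⟨b, c, hc, rfl⟩ := mem_ofPrime.1 ha.mem
    have hc0 : (c : K) ≠ 0 := fun h => hc (by
      rw [show c = 0 from Subtype.ext h]
      exact zero_mem P)
    have hb : InMax (LocalSubring.ofPrime A P) (b : K) := by
      have := ha.mul_left (LocalSubring.le_ofPrime A P c.2)
      rwa [mul_div_cancel₀ _ hc0] at this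
    rw [div_eq_mul_inv, mul_comm]
    exact InMax.mul_left (hinv c hc) ((hP b).1 ((inMax_ofPrime b).1 hb))

end OfPrime

/-! ### Charts of a blow-up and their closed points -/

theorem subring_le_blowUpChart (A : LocalSubring FF) (t : FF) :
    A.toSubring ≤ blowUpChart A t := fun _ ha => Subring.subset_closure (Or.inl ha)

theorem div_mem_blowUpChart {A : LocalSubring FF} {t a : FF} (ha : InMax A a) :
    a / t ∈ blowUpChart A t := by
  obtain ⟨h1, h2⟩ := inMax_iff.1 ha
  exact Subring.subset_closure (Or.inr ⟨_, h2, rfl⟩)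

theorem blowUpChart_le {A : LocalSubring FF} {t : FF} {D : Subring FF}
    (h : A.toSubring ≤ D) (hm : ∀ a, InMax A a → a / t ∈ D) : blowUpChart A t ≤ D := by
  refine Subring.closure_le.2 ?_
  rintro b (hb | ⟨a, ha, rfl⟩)
  · exact h hb
  · exact hm _ ((inMax_coe_iff a).2 ha)

/-- Points of the exceptional curve, described through the chart in which they lie. -/
theorem mem_exceptional_iff {A B : LocalSubring FF} : B ∈ exceptional A ↔
    ∃ t, InMax A t ∧ t ≠ 0 ∧ ∃ (𝔫 : Ideal (blowUpChart A t)) (_ : 𝔫.IsMaximal),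
      A ≤ LocalSubring.ofPrime (blowUpChart A t) 𝔫 ∧
      B = LocalSubring.ofPrime (blowUpChart A t) 𝔫 := by
  constructor
  · rintro ⟨t, ht, ht0, 𝔫, h𝔫, hc, rfl⟩
    refine ⟨t, (inMax_coe_iff t).2 ht, fun h => ht0 (Subtype.ext h), 𝔫, h𝔫, ?_, rfl⟩
    refine le_iff_inMax.2 ⟨(subring_le_blowUpChart A t).trans (LocalSubring.le_ofPrime _ _),
      fun a ha => ?_⟩
    refine (inMax_ofPrime (⟨a, subring_le_blowUpChart A t ha.mem⟩ : blowUpChart A t)).2 ?_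
    obtain ⟨h1, h2⟩ := inMax_iff.1 ha
    exact hc _ ⟨_, h2, rfl⟩
  · rintro ⟨t, ht, ht0, 𝔫, h𝔫, hle, rfl⟩
    obtain ⟨h1, h2⟩ := inMax_iff.1 ht
    refine ⟨⟨t, h1⟩, h2, fun h => ht0 (congrArg Subtype.val h), 𝔫, h𝔫, ?_, rfl⟩
    rintro c ⟨a, ha, hac⟩
    refine (inMax_ofPrime c).1 ?_
    rw [← hac]
    exact ((inMax_coe_iff a).2 ha).mono hle

theorem le_of_mem_exceptional {A B : LocalSubring FF} (h : B ∈ exceptional A) : A ≤ B := by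
  obtain ⟨t, -, -, 𝔫, _, hle, rfl⟩ := mem_exceptional_iff.1 h
  exact hle

/-- The numerator of an element of the maximal ideal has no constant term, hence lies in the ideal
spanned by the variables. -/
theorem AI.inMax_iff_exists {K : Type*} [Field K] [Algebra ℂ K] {u v a : K} (h : AI u v) :
    InMax (loc u v) a ↔
      ∃ b ∈ (loc u v).toSubring, ∃ c ∈ (loc u v).toSubring, a = b * u + c * v := by
  constructor
  · intro ha
    obtain ⟨p, q, h0, h1, hpq⟩ := ha.mem
    have hp0 : eval 0 p = 0 := by
      have e1 := (h.hasVal_aeval p).div (h.hasVal_aeval q) h0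
      rw [← hpq] at e1
      have e2 := e1.unique (InMax.hasVal e1.1 ha)
      exact (div_eq_zero_iff.1 e2).resolve_right h0
    have hp : p ∈ Ideal.span (Set.range (X : Fin 2 → MvPolynomial (Fin 2) ℂ)) := by
      rw [← Set.image_univ, mem_ideal_span_X_image]
      intro m hm
      by_contra hcon
      push Not at hcon
      have hm0 : m = 0 := by
        ext i
        exact hcon i (Set.mem_univ i)
      rw [mem_support_iff, hm0] at hm
      rw [← constantCoeff_eq, ← eval_zero] at hm
      exact hm hp0
    rw [show Set.range (X : Fin 2 → MvPolynomial (Fin 2) ℂ) = {X 0, X 1} by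
      ext; simp [Fin.exists_fin_two, eq_comm], Ideal.mem_span_pair] at hp
    obtain ⟨r, s, hrs⟩ := hp
    refine ⟨_, ⟨r, q, h0, h1, rfl⟩, _, ⟨s, q, h0, h1, rfl⟩, ?_⟩
    rw [hpq, ← hrs, map_add, map_mul, map_mul, aeval_X, aeval_X]
    simp only [Matrix.cons_val_zero, Matrix.cons_val_one]
    ring
  · rintro ⟨b, hb, c, hc, rfl⟩
    exact (h.hasVal_left.inMax.mul_left hb).add (h.hasVal_right.inMax.mul_left hc)

theorem InMax.of_le {K : Type*} [Field K] {A B : LocalSubring K} (h : A ≤ B) {a : K}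
    (ha : a ∈ A.toSubring) (hB : InMax B a) : InMax A a :=
  ⟨ha, fun h0 hi => hB.2 h0 (h.1 hi)⟩

/-- The residue field of a point of an exceptional curve is `ℂ`. -/
theorem AI.exists_hasVal_chart {u v t : FF} (h : AI u v)
    (𝔫 : Ideal (blowUpChart (loc u v) t)) [h𝔫 : 𝔫.IsMaximal]
    (hle : loc u v ≤ LocalSubring.ofPrime (blowUpChart (loc u v) t) 𝔫) :
    ∃ x y : ℂ, HasVal (LocalSubring.ofPrime (blowUpChart (loc u v) t) 𝔫) (u / t) x ∧
      HasVal (LocalSubring.ofPrime (blowUpChart (loc u v) t) 𝔫) (v / t) y := by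
  set B := LocalSubring.ofPrime (blowUpChart (loc u v) t) 𝔫 with hB
  have hcB : HasConst B := (hasConst_loc u v).mono hle
  have hchart : blowUpChart (loc u v) t ≤ B.toSubring := LocalSubring.le_ofPrime _ _
  have hut : u / t ∈ blowUpChart (loc u v) t := div_mem_blowUpChart h.hasVal_left.inMax
  have hvt : v / t ∈ blowUpChart (loc u v) t := div_mem_blowUpChart h.hasVal_right.inMax
  have hpoly : ∀ p : MvPolynomial (Fin 2) ℂ, aeval ![u / t, v / t] p ∈
      blowUpChart (loc u v) t := fun p => by
    induction p using MvPolynomial.induction_on with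
    | C c => simpa using subring_le_blowUpChart _ t (hasConst_loc u v c)
    | add p q hp hq => simpa using add_mem hp hq
    | mul_X p i hp =>
      rw [map_mul, aeval_X]
      refine mul_mem hp ?_
      fin_cases i
      exacts [hut, hvt]
  -- The chart is generated over the local ring by `u / t` and `v / t`, and elements of the local
  -- ring are congruent to constants; so polynomials in these two quotients reach every residue
  -- class.
  have happrox : ∀ c ∈ blowUpChart (loc u v) t,
      ∃ p : MvPolynomial (Fin 2) ℂ, InMax B (c - aeval ![u / t, v / t] p) := by
    have hval : ∀ a ∈ (loc u v).toSubring, ∃ z : ℂ, InMax B (a - algebraMap ℂ FF z) :=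
      fun a ha => by
        obtain ⟨z, hz⟩ := h.exists_hasVal ha
        exact ⟨z, (hz.mono hle).2⟩
    intro c hc
    induction hc using Subring.closure_induction with
    | mem c hc =>
      rcases hc with hc | ⟨a, ha, rfl⟩
      · obtain ⟨z, hz⟩ := hval c hc
        exact ⟨C z, by simpa using hz⟩
      · obtain ⟨b, hb, c, hc, hbc⟩ := h.inMax_iff_exists.1 ((inMax_coe_iff a).2 ha)
        obtain ⟨x, hx⟩ := hval b hb
        obtain ⟨y, hy⟩ := hval c hc
        refine ⟨C x * X 0 + C y * X 1, ?_⟩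
        have := (hx.mul_left (hchart hut)).add (hy.mul_left (hchart hvt))
        convert this using 1
        simp [hbc]
        ring
    | zero => exact ⟨0, by simpa using inMax_zero B⟩
    | one => exact ⟨1, by simpa using inMax_zero B⟩
    | add c d _ _ hc hd =>
      obtain ⟨p, hp⟩ := hc
      obtain ⟨q, hq⟩ := hd
      refine ⟨p + q, ?_⟩
      convert hp.add hq using 1
      rw [map_add]
      ring
    | neg c _ hc =>
      obtain ⟨p, hp⟩ := hc
      refine ⟨-p, ?_⟩
      convert hp.neg using 1
      rw [map_neg]
      ring
    | mul c d hc' hd' hc hd =>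
      obtain ⟨p, hp⟩ := hc
      obtain ⟨q, hq⟩ := hd
      refine ⟨p * q, ?_⟩
      convert (hq.mul_left (hchart hc')).add (hp.mul_left (hchart (hpoly q))) using 1
      rw [map_mul]
      ring
  -- `J` is the kernel of evaluation at `(u / t, v / t)` in the residue field. By `happrox` inverses
  -- modulo `𝔫` are represented by polynomials, which makes `J` maximal.
  let J : Ideal (MvPolynomial (Fin 2) ℂ) :=
    { carrier := {p | InMax B (aeval ![u / t, v / t] p)}
      zero_mem' := by simpa using inMax_zero B
      add_mem' := fun {p q} hp hq => by
        simpa only [Set.mem_ofPred_eq, map_add] using InMax.add hp hq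
      smul_mem' := fun p q hq => by
        simpa only [Set.mem_ofPred_eq, smul_eq_mul, map_mul] using
          InMax.mul_left (hchart (hpoly p)) hq }
  have hJ : J.IsMaximal := by
    refine Ideal.isMaximal_iff.2 ⟨fun h1 => not_inMax_one B (by
      have : InMax B (aeval ![u / t, v / t] (1 : MvPolynomial (Fin 2) ℂ)) := h1
      simpa using this), fun J' p hJJ' hp hp' => ?_⟩
    have hp1 : (⟨_, hpoly p⟩ : blowUpChart (loc u v) t) ∉ 𝔫 := fun hn =>
      hp ((inMax_ofPrime (⟨_, hpoly p⟩ : blowUpChart (loc u v) t)).2 hn)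
    obtain ⟨d, hd⟩ := h𝔫.exists_inv hp1
    obtain ⟨i, hi, hdi⟩ := hd
    obtain ⟨q, hq⟩ := happrox d d.2
    have hi' : InMax B (i : FF) := (inMax_ofPrime i).2 hi
    have hdi' : (d : FF) * aeval ![u / t, v / t] p + i = 1 := congrArg Subtype.val hdi
    have hmem : 1 - q * p ∈ J := by
      change InMax B (aeval ![u / t, v / t] (1 - q * p))
      convert (hq.mul_left (hchart (hpoly p))).add hi' using 1
      rw [map_sub, map_one, map_mul, ← hdi']
      ring
    have := J'.add_mem (hJJ' hmem) (J'.mul_mem_left q hp')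
    rwa [sub_add_cancel] at this
  -- The Nullstellensatz: `J` is the ideal of a point `(x 0, x 1)`, and these are the required
  -- values.
  obtain ⟨x, hx⟩ := isMaximal_iff_eq_vanishingIdeal_singleton.1 hJ
  have hXi : ∀ i, InMax B (aeval ![u / t, v / t] (X i - C (x i) : MvPolynomial (Fin 2) ℂ)) := by
    intro i
    change X i - C (x i) ∈ J
    rw [hx, mem_vanishingIdeal_singleton_iff]
    simp
  exact ⟨x 0, x 1, ⟨hcB, by simpa using hXi 0⟩, ⟨hcB, by simpa using hXi 1⟩⟩

theorem AI.loc_le_div_sub {u v : FF} (h : AI u v) (c : ℂ) :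
    loc u v ≤ loc u (v / u - algebraMap ℂ FF c) := by
  have hD := h.div_sub c
  refine loc_le hD.hasVal_left ?_
  exact (hD.hasVal_right.of_sub.mul hD.hasVal_left).congr
    (div_mul_cancel₀ v h.left_ne_zero).symm (by simp)

theorem AI.chart_le {u v t : FF} (h : AI u v) {c : ℂ}
    (ht : u / t ∈ (loc u (v / u - algebraMap ℂ FF c)).toSubring) :
    blowUpChart (loc u v) t ≤ (loc u (v / u - algebraMap ℂ FF c)).toSubring := by
  have hD := h.div_sub c
  have hAD := h.loc_le_div_sub c
  have hvu := hD.hasVal_right.of_sub.mem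
  refine blowUpChart_le hAD.1 fun a ha => ?_
  obtain ⟨b, hb, d, hd, rfl⟩ := h.inMax_iff_exists.1 ha
  have := mul_mem (add_mem (hAD.1 hb) (mul_mem (hAD.1 hd) hvu)) ht
  have hu := h.left_ne_zero
  convert this using 1
  field_simp

/-- The right side is dominated by the left one through `loc_le`. Conversely `t / u` lies in the
right side and is a unit in the left one, hence a unit in the right side; so the whole chart of `t`
is contained there. -/
theorem AI.ofPrime_eq {u v t : FF} (h : AI u v) (ht : InMax (loc u v) t) (ht0 : t ≠ 0)
    (𝔫 : Ideal (blowUpChart (loc u v) t)) [h𝔫 : 𝔫.IsMaximal]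
    (hle : loc u v ≤ LocalSubring.ofPrime (blowUpChart (loc u v) t) 𝔫) {x y : ℂ} (hx0 : x ≠ 0)
    (hx : HasVal (LocalSubring.ofPrime (blowUpChart (loc u v) t) 𝔫) (u / t) x)
    (hy : HasVal (LocalSubring.ofPrime (blowUpChart (loc u v) t) 𝔫) (v / t) y) :
    LocalSubring.ofPrime (blowUpChart (loc u v) t) 𝔫 =
      loc u (v / u - algebraMap ℂ FF (y / x)) := by
  have hu := h.left_ne_zero
  have hD := h.div_sub (y / x)
  have hAD := h.loc_le_div_sub (y / x)
  have hvu := hD.hasVal_right.of_sub.mem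
  set B := LocalSubring.ofPrime (blowUpChart (loc u v) t) 𝔫 with hB
  have hDB : loc u (v / u - algebraMap ℂ FF (y / x)) ≤ B := by
    refine loc_le (h.hasVal_left.mono hle) ?_
    refine HasVal.sub_const ((hy.div hx hx0).congr ?_ rfl)
    field_simp
  refine le_antisymm ?_ hDB
  have htu : u / t ∈ (loc u (v / u - algebraMap ℂ FF (y / x))).toSubring := by
    rw [← inv_div t u]
    refine inv_mem_of_le hDB ?_ (div_ne_zero ht0 hu) (by rw [inv_div]; exact hx.mem)
    obtain ⟨b, hb, d, hd, rfl⟩ := h.inMax_iff_exists.1 ht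
    have := add_mem (hAD.1 hb) (mul_mem (hAD.1 hd) hvu)
    convert this using 1
    field_simp
  refine ofPrime_le (h.chart_le htu) fun a => ?_
  rw [← inMax_ofPrime]
  exact ⟨fun ha => ha.of_le hDB (h.chart_le htu a.2), fun ha => ha.mono hDB⟩

theorem AI.mem_exceptional {u v : FF} (h : AI u v) (c : ℂ) :
    loc u (v / u - algebraMap ℂ FF c) ∈ exceptional (loc u v) := by
  have hu := h.left_ne_zero
  have hD := h.div_sub c
  have hAD := h.loc_le_div_sub c
  set D := loc u (v / u - algebraMap ℂ FF c) with hDdef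
  have hchart : blowUpChart (loc u v) u ≤ D.toSubring :=
    h.chart_le (by rw [div_self hu]; exact one_mem _)
  -- The chart is the one with `t = u`, and the ideal is the trace of the maximal ideal of `D`. It
  -- is maximal since elements of `D` have values in `ℂ`.
  let 𝔫 : Ideal (blowUpChart (loc u v) u) :=
    { carrier := {a | InMax D (a : FF)}
      zero_mem' := inMax_zero D
      add_mem' := fun ha hb => InMax.add ha hb
      smul_mem' := fun a b hb => InMax.mul_left (hchart a.2) hb }
  have hmem : ∀ a, a ∈ 𝔫 ↔ InMax D (a : FF) := fun a => Iff.rfl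
  have hconst : ∀ z : ℂ, algebraMap ℂ FF z ∈ blowUpChart (loc u v) u := fun z =>
    subring_le_blowUpChart _ u (hasConst_loc u v z)
  have h𝔫 : 𝔫.IsMaximal := by
    refine Ideal.isMaximal_iff.2 ⟨fun h1 => not_inMax_one D h1, fun J a hJ ha ha' => ?_⟩
    obtain ⟨z, hz⟩ := hD.exists_hasVal (hchart a.2)
    have hz0 : z ≠ 0 := by
      rintro rfl
      exact ha hz.inMax
    have h1 : 1 - a * ⟨_, hconst z⁻¹⟩ ∈ 𝔫 := by
      rw [hmem]
      refine HasVal.inMax ((hz.1.one.sub (hz.mul (hz.1.val z⁻¹))).congr rfl ?_)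
      rw [mul_inv_cancel₀ hz0, sub_self]
    have := J.add_mem (hJ h1) (J.mul_mem_right ⟨_, hconst z⁻¹⟩ ha')
    rwa [sub_add_cancel] at this
  have hBD : LocalSubring.ofPrime (blowUpChart (loc u v) u) 𝔫 ≤ D := ofPrime_le hchart hmem
  have hcB : HasConst (LocalSubring.ofPrime (blowUpChart (loc u v) u) 𝔫) := fun z =>
    LocalSubring.le_ofPrime _ _ (hconst z)
  have hDB : D ≤ LocalSubring.ofPrime (blowUpChart (loc u v) u) 𝔫 := by
    refine loc_le ?_ ?_
    · exact InMax.hasVal hcB (hD.hasVal_left.inMax.of_le hBD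
        (LocalSubring.le_ofPrime _ _ (subring_le_blowUpChart _ u h.hasVal_left.mem)))
    · refine InMax.hasVal hcB (hD.hasVal_right.inMax.of_le hBD (LocalSubring.le_ofPrime _ _ ?_))
      exact sub_mem (div_mem_blowUpChart h.hasVal_right.inMax) (hconst c)
  have heq := le_antisymm hBD hDB
  exact mem_exceptional_iff.2 ⟨u, h.hasVal_left.inMax, hu, 𝔫, h𝔫, heq ▸ hAD, heq.symm⟩

theorem AI.mem_exceptional_infty {u v : FF} (h : AI u v) :
    loc v (u / v) ∈ exceptional (loc u v) := by
  rw [loc_comm u v]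
  simpa using h.symm.mem_exceptional 0

/-- The exceptional curve of a point with local coordinates `u`, `v` is a projective line with
coordinate `v / u`. -/
theorem AI.mem_exceptional_iff {u v : FF} (h : AI u v) {B : LocalSubring FF} :
    B ∈ exceptional (loc u v) ↔
      (∃ c : ℂ, B = loc u (v / u - algebraMap ℂ FF c)) ∨ B = loc v (u / v) := by
  constructor
  · intro hB
    obtain ⟨t, ht, ht0, 𝔫, h𝔫, hle, rfl⟩ := Cremona.mem_exceptional_iff.1 hB
    obtain ⟨x, y, hx, hy⟩ := h.exists_hasVal_chart 𝔫 hle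
    by_cases hx0 : x = 0
    · right
      obtain ⟨b, hb, d, hd, hbd⟩ := h.inMax_iff_exists.1 ht
      obtain ⟨β, hβ⟩ := h.exists_hasVal hb
      obtain ⟨δ, hδ⟩ := h.exists_hasVal hd
      have h1 := ((hβ.mono hle).mul hx).add ((hδ.mono hle).mul hy)
      have h2 : b * (u / t) + d * (v / t) = 1 := by
        rw [mul_div_assoc', mul_div_assoc', ← add_div, ← hbd, div_self ht0]
      rw [h2] at h1
      have h3 := h1.unique h1.1.one
      -- From `t = b u + d v` follows `1 = b (u / t) + d (v / t)`, so the two quotients cannot both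
      -- vanish. Thus `u` and `v` can exchange roles.
      have hy0 : y ≠ 0 := by
        rintro rfl
        simp [hx0] at h3
      have h4 := h.symm
      have h5 := loc_comm u v
      clear h1 h2 h3 hβ hδ hbd hb hd hB
      -- The type of `𝔫` mentions `loc u v`, so the ideal has to be generalized before this is
      -- rewritten as `loc v u`.
      revert 𝔫
      rw [h5] at ht ⊢
      intro 𝔫 h𝔫 hle hx hy
      rw [h4.ofPrime_eq ht ht0 𝔫 hle hy0 hy hx, hx0]
      simp
    · exact Or.inl ⟨_, h.ofPrime_eq ht ht0 𝔫 hle hx0 hx hy⟩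
  · rintro (⟨c, rfl⟩ | rfl)
    exacts [h.mem_exceptional c, h.mem_exceptional_infty]

/-! ### Separated surfaces -/

section Comap

variable {K L : Type*} [Field K] [Field L]

theorem isLocalRing_comap (φ : K →+* L) (C : LocalSubring L) :
    IsLocalRing (C.toSubring.comap φ) := by
  refine IsLocalRing.of_isUnit_or_isUnit_one_sub_self fun a => ?_
  have key : ∀ b : C.toSubring.comap φ, ¬ InMax C (φ b) → IsUnit b := fun b hb => by
    have hb0 : (b : K) ≠ 0 := fun h => hb (by rw [h, map_zero]; exact inMax_zero C)
    have hi : φ (b : K)⁻¹ ∈ C.toSubring := by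
      rw [map_inv₀]
      by_contra hn
      exact hb ⟨b.2, fun _ => hn⟩
    exact IsUnit.of_mul_eq_one ⟨(b : K)⁻¹, hi⟩ (Subtype.ext (by simp [hb0]))
  by_cases h : InMax C (φ a)
  · refine Or.inr (key _ fun h' => not_inMax_one C ?_)
    convert h.add h' using 1
    simp
  · exact Or.inl (key a h)

theorem map_le_map_iff {A B : LocalSubring K} (φ : K →+* L) :
    A.map φ ≤ B.map φ ↔ A ≤ B := by
  rw [le_iff_inMax, le_iff_inMax]
  constructor
  · rintro ⟨h1, h2⟩
    exact ⟨fun a ha => (mem_map_iff φ).1 (h1 ((mem_map_iff φ).2 ha)),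
      fun a ha => (inMax_map_iff φ).1 (h2 _ ((inMax_map_iff φ).2 ha))⟩
  · rintro ⟨h1, h2⟩
    refine ⟨?_, fun b hb => ?_⟩
    · rintro _ ⟨a, ha, rfl⟩
      exact ⟨a, h1 ha, rfl⟩
    · obtain ⟨a, ha, rfl⟩ := hb.mem
      exact (inMax_map_iff φ).2 (h2 a ((inMax_map_iff φ).1 hb))

theorem map_injective (φ : K →+* L) : Function.Injective (LocalSubring.map φ) := fun _ _ h =>
  le_antisymm ((map_le_map_iff φ).1 h.le) ((map_le_map_iff φ).1 h.ge)

theorem localSubring_map_map {M : Type*} [Field M] (φ : K →+* L) (ψ : L →+* M)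
    (A : LocalSubring K) : (A.map φ).map ψ = A.map (ψ.comp φ) :=
  LocalSubring.ext (Subring.map_map _ _ _)

/-- The preimage of a local ring under an embedding of fields. -/
def comapLocal (φ : K →+* L) (C : LocalSubring L) : LocalSubring K :=
  @LocalSubring.mk K _ (C.toSubring.comap φ) (isLocalRing_comap φ C)

theorem le_comapLocal {φ : K →+* L} {B : LocalSubring K} {C : LocalSubring L}
    (h : B.map φ ≤ C) : B ≤ comapLocal φ C := by
  refine le_iff_inMax.2 ⟨fun a ha => h.1 ((mem_map_iff φ).2 ha), fun a ha => ?_⟩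
  have h1 := ((inMax_map_iff φ).2 ha).mono h
  exact ⟨h1.mem, fun h0 hi => h1.2 ((map_ne_zero φ).2 h0) (by rw [← map_inv₀]; exact hi)⟩

end Comap

/-- The point has local coordinates in the field `k`. -/
def IsPt (k : Set FF) (A : LocalSubring FF) : Prop :=
  ∃ u ∈ k, ∃ v ∈ k, AI u v ∧ A = loc u v

/-- A separated surface: its points have local coordinates, and no local ring dominates two of
them. -/
structure IsSurf (k : Set FF) (X : Set (LocalSubring FF)) : Prop where
  pts : ∀ A ∈ X, IsPt k A
  sep : ∀ A ∈ X, ∀ B ∈ X, ∀ C, A ≤ C → B ≤ C → A = B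

section Surfaces

variable {k : IntermediateField ℂ FF} {X : Set (LocalSubring FF)} {A B : LocalSubring FF}

theorem IsPt.of_mem_exceptional (hA : IsPt k A) (hB : B ∈ exceptional A) : IsPt k B := by
  obtain ⟨u, hu, v, hv, h, rfl⟩ := hA
  rcases h.mem_exceptional_iff.1 hB with ⟨c, rfl⟩ | rfl
  · exact ⟨u, hu, _, k.sub_mem (k.div_mem hv hu) (k.algebraMap_mem c), h.div_sub c, rfl⟩
  · exact ⟨v, hv, _, k.div_mem hu hv, h.symm.div, rfl⟩

/-- In `C` the function `v / u` would have a finite value and its inverse the value `0`, so that `1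
= 0`. -/
theorem AI.exceptional_sep_infty {u v : FF} (h : AI u v) {C : LocalSubring FF} {c : ℂ}
    (h1 : loc u (v / u - algebraMap ℂ FF c) ≤ C) (h2 : loc v (u / v) ≤ C) : False := by
  have e1 := ((h.div_sub c).loc_le_iff.1 h1).2.of_sub
  have e2 := (h.symm.div.loc_le_iff.1 h2).2
  have e3 := e1.mul e2
  rw [div_mul_div_cancel₀ h.left_ne_zero, div_self h.right_ne_zero, mul_zero] at e3
  exact one_ne_zero (e1.1.one.unique e3)

theorem IsPt.exceptional_sep (hA : IsPt k A) {B B' C : LocalSubring FF} (hB : B ∈ exceptional A)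
    (hB' : B' ∈ exceptional A) (h1 : B ≤ C) (h2 : B' ≤ C) : B = B' := by
  obtain ⟨u, hu, v, hv, h, rfl⟩ := hA
  rcases h.mem_exceptional_iff.1 hB with ⟨c, rfl⟩ | rfl <;>
    rcases h.mem_exceptional_iff.1 hB' with ⟨c', rfl⟩ | rfl
  · have e1 := ((h.div_sub c).loc_le_iff.1 h1).2.of_sub
    have e2 := ((h.div_sub c').loc_le_iff.1 h2).2.of_sub
    rw [e1.unique e2]
  · exact (h.exceptional_sep_infty h1 h2).elim
  · exact (h.exceptional_sep_infty h2 h1).elim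
  · rfl

namespace IsSurf

/-- The preimage of `C` under `φ` dominates both `A` and `B`. This makes the image of a point under
a rational map to a separated surface unique. -/
theorem image_unique (hX : IsSurf k X) (hA : A ∈ X) (hB : B ∈ X) {φ : FF →+* FF}
    {C : LocalSubring FF} (h1 : A.map φ ≤ C) (h2 : B.map φ ≤ C) : A = B :=
  hX.sep A hA B hB _ (le_comapLocal h1) (le_comapLocal h2)

theorem eq_of_le (hX : IsSurf k X) (hA : A ∈ X) (hB : B ∈ X) (h : A ≤ B) : A = B :=
  hX.sep A hA B hB B h le_rfl

/-- A point of the exceptional curve dominates `A`. If it shared a dominating ring with an old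
point, separatedness of `X` would identify that old point with `A`, which has been removed. -/
protected theorem blowUp (hX : IsSurf k X) (hA : A ∈ X) : IsSurf k (blowUp X A) where
  pts := by
    rintro B (hB | hB)
    · exact hX.pts B hB.1
    · exact (hX.pts A hA).of_mem_exceptional hB
  sep := by
    rintro B (hB | hB) B' (hB' | hB') C h1 h2
    · exact hX.sep B hB.1 B' hB'.1 C h1 h2
    · exact (hB.2 (hX.sep B hB.1 A hA C h1 ((le_of_mem_exceptional hB').trans h2))).elim
    · exact (hB'.2 (hX.sep B' hB'.1 A hA C h2 ((le_of_mem_exceptional hB).trans h1))).elim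
    · exact (hX.pts A hA).exceptional_sep hB hB' h1 h2

protected theorem bl (hX : IsSurf k X) {l : List (LocalSubring FF)} (hl : IsPointList X l) :
    IsSurf k (Bl X l) := by
  induction l generalizing X with
  | nil => exact hX
  | cons A l ih => exact ih (hX.blowUp hl.1) hl.2

theorem not_mem_exceptional (hX : IsSurf k X) (hA : A ∈ X) (hB : B ∈ X) (h : A ≠ B) :
    A ∉ exceptional B := fun hn => h (hX.eq_of_le hB hA (le_of_mem_exceptional hn)).symm

theorem blowUp_comm (hX : IsSurf k X) (hA : A ∈ X) (hB : B ∈ X) (h : A ≠ B) :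
    blowUp (blowUp X A) B = blowUp (blowUp X B) A := by
  have h1 := hX.not_mem_exceptional hA hB h
  have h2 := hX.not_mem_exceptional hB hA h.symm
  ext D
  have h3 : D ∈ exceptional A → D ≠ B := fun hD hDB => h2 (hDB ▸ hD)
  have h4 : D ∈ exceptional B → D ≠ A := fun hD hDA => h1 (hDA ▸ hD)
  simp only [blowUp, Set.mem_union, Set.mem_sdiff, Set.mem_singleton_iff]
  tauto

/-- A point which is blown up at some stage can be blown up first. -/
theorem exists_list_of_notMem (hX : IsSurf k X) (hA : A ∈ X) {η : List (LocalSubring FF)}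
    (hη : IsPointList X η) (hn : A ∉ Bl X η) :
    ∃ θ, IsPointList (blowUp X A) θ ∧ Bl (blowUp X A) θ = Bl X η := by
  induction η generalizing X with
  | nil => exact absurd hA hn
  | cons B η ih =>
    by_cases hAB : A = B
    · subst hAB
      exact ⟨η, hη.2, rfl⟩
    -- `A` survives the blow-up of `B`, so the induction hypothesis applies on `blowUp X B`;
    -- commuting the first two blow-ups then puts `A` in front of `B`.
    · obtain ⟨θ, h1, h2⟩ := ih (hX.blowUp hη.1) (Or.inl ⟨hA, hAB⟩) hη.2 hn
      rw [← hX.blowUp_comm hA hη.1 hAB] at h1 h2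
      exact ⟨B :: θ, ⟨Or.inl ⟨hη.1, Ne.symm hAB⟩, h1⟩, h2⟩

/-- The points of `ξ` are moved to the front one after the other. Each move changes the remaining
list but not the final surface, so the absence of the further points of `ξ` persists. -/
theorem exists_list_of_forall_notMem (hX : IsSurf k X) {ξ η : List (LocalSubring FF)}
    (hξ : IsPointList X ξ) (hη : IsPointList X η) (hn : ∀ A ∈ ξ, A ∉ Bl X η) :
    ∃ θ, IsPointList (Bl X ξ) θ ∧ Bl (Bl X ξ) θ = Bl X η := by
  induction ξ generalizing X η with
  | nil => exact ⟨η, hη, rfl⟩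
  | cons A ξ ih =>
    obtain ⟨θ, h1, h2⟩ := hX.exists_list_of_notMem hξ.1 hη (hn A (by simp))
    obtain ⟨θ', h3, h4⟩ := ih (hX.blowUp hξ.1) hξ.2 h1 fun B hB => by
      rw [h2]
      exact hn B (by simp [hB])
    exact ⟨θ', h3, h4.trans h2⟩

end IsSurf

/-- Blowing up points of indeterminacy until the map is regular is the minimal
desingularization. -/
theorem BirMap.isMinimalDesingularization_of_forall_not_regularAt (hP : IsSurf k plane)
    {f : BirMap} {ξ : List (LocalSubring FF)} (hξ : IsPointList plane ξ)
    (hreg : ∀ A ∈ Bl plane ξ, f.RegularAt plane A) (hn : ∀ A ∈ ξ, ¬ f.RegularAt plane A) :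
    f.IsMinimalDesingularization ξ :=
  ⟨hξ, hreg, fun _ hη hηreg =>
    hP.exists_list_of_forall_notMem hξ hη fun A hA hA' => hn A hA (hηreg A hA')⟩

end Surfaces

/-! ### Points of the plane in affine coordinates -/

theorem aeval_mul_of_isHomogeneous {σ R : Type*} [CommRing R] [Algebra ℂ R] {n : ℕ}
    {p : MvPolynomial σ ℂ} (hp : p.IsHomogeneous n) (a : R) (g : σ → R) :
    aeval (fun i => a * g i) p = a ^ n * aeval g p := by
  rw [aeval_def, aeval_def, eval₂_eq, eval₂_eq, Finset.mul_sum]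
  refine Finset.sum_congr rfl fun d hd => ?_
  have hdn : ∑ i ∈ d.support, d i = n := by
    rw [← hp (mem_support_iff.mp hd), Finsupp.weight_apply, Finsupp.sum]
    simp
  simp only [mul_pow, Finset.prod_mul_distrib, Finset.prod_pow_eq_pow_sum, hdn]
  ring

/-- A constant, as a rational function. -/
local notation "κ" => algebraMap ℂ FF

/-- A coordinate, as a rational function. -/
def coord (i : Fin 3) : FF := algebraMap Coord FF (X i)

theorem algebraMap_coord_injective : Function.Injective (algebraMap Coord FF) :=
  IsFractionRing.injective Coord FF

theorem algebraMap_C (c : ℂ) : algebraMap Coord FF (C c) = κ c :=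
  (IsScalarTower.algebraMap_apply ℂ Coord FF c).symm

theorem coord_ne_zero (i : Fin 3) : coord i ≠ 0 := fun h =>
  X_ne_zero (R := ℂ) i (algebraMap_coord_injective (by rw [map_zero]; exact h))

theorem algebraMap_eq_aeval (p : Coord) : algebraMap Coord FF p = aeval coord p := by
  induction p using MvPolynomial.induction_on with
  | C c => rw [algebraMap_C, aeval_C]
  | add p q hp hq => rw [map_add, map_add, hp, hq]
  | mul_X p i hp => rw [map_mul, map_mul, hp, aeval_X, coord]

theorem algebraMap_of_isHomogeneous {n : ℕ} {F : Coord} (hF : F.IsHomogeneous n) (i : Fin 3) :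
    algebraMap Coord FF F = coord i ^ n * aeval (fun l => coord l / coord i) F := by
  rw [← aeval_mul_of_isHomogeneous hF, algebraMap_eq_aeval]
  congr 2
  ext l
  rw [mul_div_cancel₀ _ (coord_ne_zero i)]

theorem eval_of_isHomogeneous {n : ℕ} {F : Coord} (hF : F.IsHomogeneous n) {v : Fin 3 → ℂ}
    {i : Fin 3} (hi : v i ≠ 0) : eval v F = v i ^ n * eval (fun l => v l / v i) F := by
  have := aeval_mul_of_isHomogeneous hF (v i) (fun l => v l / v i)
  simp only [mul_div_cancel₀ _ hi] at this
  simpa [coe_aeval_eq_eval] using this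

theorem algebraMap_ne_zero_of_eval {v : Fin 3 → ℂ} {G : Coord} (h : eval v G ≠ 0) :
    algebraMap Coord FF G ≠ 0 := fun h0 => h (by
  rw [IsFractionRing.to_map_eq_zero_iff] at h0
  rw [h0, map_zero])

theorem hasConst_planePoint (v : Fin 3 → ℂ) : HasConst (planePoint v) := fun c =>
  ⟨0, C c, 1, isHomogeneous_C _ _, isHomogeneous_one _ _, by simp, by
    rw [algebraMap_C, map_one, div_one]⟩

theorem hasVal_planePoint {v : Fin 3 → ℂ} {n : ℕ} {F G : Coord} (hF : F.IsHomogeneous n)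
    (hG : G.IsHomogeneous n) (hv : eval v G ≠ 0) :
    HasVal (planePoint v) (algebraMap Coord FF F / algebraMap Coord FF G)
      (eval v F / eval v G) := by
  have key : ∀ F : Coord, F.IsHomogeneous n → eval v F = 0 →
      InMax (planePoint v) (algebraMap Coord FF F / algebraMap Coord FF G) := by
    intro F hF h0
    refine ⟨⟨n, F, G, hF, hG, hv, rfl⟩, ?_⟩
    rintro hne ⟨m, F', G', -, -, hv', h⟩
    have h1 := algebraMap_ne_zero_of_eval hv'
    have h2 : algebraMap Coord FF F ≠ 0 := fun h => hne (by rw [h, zero_div])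
    rw [inv_div, div_eq_div_iff h2 h1, ← map_mul, ← map_mul] at h
    have h3 := congrArg (eval v) (algebraMap_coord_injective h)
    rw [map_mul, map_mul, h0, mul_zero] at h3
    exact mul_ne_zero hv hv' h3
  refine ⟨hasConst_planePoint v, ?_⟩
  have h1 := algebraMap_ne_zero_of_eval hv
  have := key (F - C (eval v F / eval v G) * G) (hF.sub (hG.C_mul _))
    (by simp [div_mul_cancel₀ _ hv])
  rwa [map_sub, map_mul, sub_div, mul_div_cancel_right₀ _ h1, algebraMap_C] at this

theorem hasVal_planePoint_coord {v : Fin 3 → ℂ} {i : Fin 3} (hi : v i ≠ 0) (l : Fin 3) :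
    HasVal (planePoint v) (coord l / coord i) (v l / v i) := by
  simpa [coord] using hasVal_planePoint (v := v) (isHomogeneous_X ℂ l) (isHomogeneous_X ℂ i) (by simpa)

/-- The analogue of `loc_le` in homogeneous coordinates: dehomogenizing by the `i`-th coordinate
shows that each function regular at `v` has the same value in `A`. -/
theorem planePoint_le {v : Fin 3 → ℂ} {i : Fin 3} (hi : v i ≠ 0) {A : LocalSubring FF}
    (h : ∀ l, HasVal A (coord l / coord i) (v l / v i)) : planePoint v ≤ A := by
  have hA := (h 0).1
  have key : ∀ a ∈ (planePoint v).toSubring, ∃ c, HasVal (planePoint v) a c ∧ HasVal A a c := by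
    rintro _ ⟨n, F, G, hF, hG, hv, rfl⟩
    refine ⟨_, hasVal_planePoint hF hG hv, ?_⟩
    have hv' : eval (fun l => v l / v i) G ≠ 0 := fun h0 => hv (by
      rw [eval_of_isHomogeneous hG hi, h0, mul_zero])
    have h1 := (HasVal.aeval hA h F).div (HasVal.aeval hA h G) hv'
    refine h1.congr ?_ ?_
    · rw [algebraMap_of_isHomogeneous hF i, algebraMap_of_isHomogeneous hG i,
        mul_div_mul_left _ _ (pow_ne_zero _ (coord_ne_zero i))]
    · rw [eval_of_isHomogeneous hF hi, eval_of_isHomogeneous hG hi,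
        mul_div_mul_left _ _ (pow_ne_zero _ hi)]
  refine le_iff_inMax.2 ⟨fun a ha => ?_, fun a ha => ?_⟩
  · obtain ⟨c, -, hc⟩ := key a ha
    exact hc.mem
  · obtain ⟨c, hc, hc'⟩ := key a ha.mem
    rw [hc.unique (InMax.hasVal hc.1 ha)] at hc'
    exact hc'.inMax

/-- The coordinate `y / x`. -/
def cy : FF := coord 1 / coord 0

/-- The function `(x z + y ^ 2) / x ^ 2`, which is a local equation of the conic `C`. -/
def cw : FF := (coord 0 * coord 2 + coord 1 ^ 2) / coord 0 ^ 2

theorem algebraicIndependent_coord : AlgebraicIndependent ℂ coord := by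
  have := (algebraicIndependent_X (Fin 3) ℂ).map' (f := IsScalarTower.toAlgHom ℂ Coord FF)
    algebraMap_coord_injective
  exact this

/-- Together with `coord 0` these two functions generate all three coordinates, so the triple is
independent, and so is the pair. -/
theorem AI_cy_cw : AI cy cw := by
  have h : AlgebraicIndependent ℂ ![coord 0, cy, cw] := by
    refine algebraicIndependent_of_mem_adjoin algebraicIndependent_coord fun i => ?_
    set E := IntermediateField.adjoin ℂ (Set.range ![coord 0, cy, cw])
    have h0 : coord 0 ∈ E := IntermediateField.subset_adjoin ℂ _ ⟨0, rfl⟩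
    have h1 : cy ∈ E := IntermediateField.subset_adjoin ℂ _ ⟨1, rfl⟩
    have h2 : cw ∈ E := IntermediateField.subset_adjoin ℂ _ ⟨2, rfl⟩
    have hx := coord_ne_zero 0
    fin_cases i
    · exact h0
    · have := E.mul_mem h1 h0
      rwa [cy, div_mul_cancel₀ _ hx] at this
    · have := E.mul_mem (E.sub_mem h2 (E.pow_mem h1 2)) h0
      convert this using 1
      simp only [cy, cw]
      field_simp
      simp [mul_comm]
  have := h.comp Fin.succ (Fin.succ_injective 2)
  rwa [show ![coord 0, cy, cw] ∘ Fin.succ = ![cy, cw] by ext i; fin_cases i <;> rfl] at this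

theorem cy_ne_zero : cy ≠ 0 := AI_cy_cw.left_ne_zero

theorem cw_ne_zero : cw ≠ 0 := AI_cy_cw.right_ne_zero

theorem coord_two_div_zero : coord 2 / coord 0 = cw - cy ^ 2 := by
  have hx := coord_ne_zero 0
  simp only [cy, cw]
  field_simp
  ring

theorem cw_sub_ne_zero : cw - cy ^ 2 ≠ 0 := by
  rw [← coord_two_div_zero]
  exact div_ne_zero (coord_ne_zero 2) (coord_ne_zero 0)

theorem coord_zero_div_one : coord 0 / coord 1 = 1 / cy := by
  rw [cy, one_div_div]

theorem coord_two_div_one : coord 2 / coord 1 = cw / cy - cy := by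
  have h := coord_two_div_zero
  have hx := coord_ne_zero 0
  have hy := coord_ne_zero 1
  have h0 := cy_ne_zero
  rw [show cw / cy - cy = (cw - cy ^ 2) / cy by field_simp, ← h, cy]
  field_simp

theorem coord_zero_div_two : coord 0 / coord 2 = 1 / (cw - cy ^ 2) := by
  rw [← coord_two_div_zero, one_div_div]

theorem coord_one_div_two : coord 1 / coord 2 = cy / (cw - cy ^ 2) := by
  have hx := coord_ne_zero 0
  rw [← coord_two_div_zero, cy]
  field_simp

/-- The point of the plane at which `y / x`, `(x z + y ^ 2) / x ^ 2` take the values `a`, `b`. -/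
def affPt (a b : ℂ) : LocalSubring FF := loc (cy - κ a) (cw - κ b)

/-- The point `(0 : 1 : t)`. -/
def delPt (t : ℂ) : LocalSubring FF := loc (1 / cy) (cw / cy - cy - κ t)

theorem AI_affPt (a b : ℂ) : AI (cy - κ a) (cw - κ b) := AI_cy_cw.sub_const a b

theorem AI_delPt (t : ℂ) : AI (1 / cy) (cw / cy - cy - κ t) := by
  have hy := cy_ne_zero
  have h1 : ∀ E : IntermediateField ℂ FF, 1 / cy ∈ E → cy ∈ E := fun E h => by
    simpa using E.inv_mem h
  refine AI_cy_cw.of_mem_adjoin (fun E h _ => h1 E h) fun E h h' => ?_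
  have := E.mul_mem (E.add_mem (E.add_mem h' (E.algebraMap_mem t)) (h1 E h)) (h1 E h)
  convert this using 1
  field_simp
  ring

theorem AI_pointP : AI (1 / (cw - cy ^ 2)) (cy / (cw - cy ^ 2)) := by
  have hq := cw_sub_ne_zero
  have h1 : ∀ E : IntermediateField ℂ FF, 1 / (cw - cy ^ 2) ∈ E →
      cy / (cw - cy ^ 2) ∈ E → cy ∈ E := fun E h h' => by
    have := E.div_mem h' h
    rwa [div_div_div_cancel_right₀ hq, div_one] at this
  refine AI_cy_cw.of_mem_adjoin h1 fun E h h' => ?_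
  have := E.add_mem (E.inv_mem h) (E.pow_mem (h1 E h h') 2)
  simpa using this

theorem affPt_val_cy (a b : ℂ) : HasVal (affPt a b) cy a := (AI_affPt a b).hasVal_left.of_sub

theorem affPt_val_cw (a b : ℂ) : HasVal (affPt a b) cw b := (AI_affPt a b).hasVal_right.of_sub

theorem delPt_val_left (t : ℂ) : HasVal (delPt t) (1 / cy) 0 := (AI_delPt t).hasVal_left

theorem delPt_val_right (t : ℂ) : HasVal (delPt t) (cw / cy - cy) t :=
  (AI_delPt t).hasVal_right.of_sub

theorem planePoint_eq_affPt {v : Fin 3 → ℂ} (h : v 0 ≠ 0) :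
    planePoint v = affPt (v 1 / v 0) ((v 0 * v 2 + v 1 ^ 2) / v 0 ^ 2) := by
  have hy : HasVal (planePoint v) cy (v 1 / v 0) := hasVal_planePoint_coord h 1
  have hz : HasVal (planePoint v) (cw - cy ^ 2) (v 2 / v 0) := by
    rw [← coord_two_div_zero]
    exact hasVal_planePoint_coord h 2
  have hy' := affPt_val_cy (v 1 / v 0) ((v 0 * v 2 + v 1 ^ 2) / v 0 ^ 2)
  have hw' := affPt_val_cw (v 1 / v 0) ((v 0 * v 2 + v 1 ^ 2) / v 0 ^ 2)
  refine le_antisymm (planePoint_le h fun l => ?_) (loc_le hy.sub_const ?_)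
  · fin_cases l
    · exact hy'.1.one.congr (div_self (coord_ne_zero 0)) (div_self h)
    · exact hy'
    · refine (hw'.sub (hy'.pow 2)).congr coord_two_div_zero ?_
      simp only [Fin.reduceFinMk]
      field_simp
      ring
  · refine HasVal.sub_const ((hz.add (hy.pow 2)).congr (by ring) ?_)
    field_simp

theorem planePoint_eq_delPt {v : Fin 3 → ℂ} (h : v 0 = 0) (h1 : v 1 ≠ 0) :
    planePoint v = delPt (v 2 / v 1) := by
  have hx : HasVal (planePoint v) (1 / cy) 0 := by
    have := hasVal_planePoint_coord h1 0
    rwa [coord_zero_div_one, h, zero_div] at this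
  have hz : HasVal (planePoint v) (cw / cy - cy) (v 2 / v 1) := by
    rw [← coord_two_div_one]
    exact hasVal_planePoint_coord h1 2
  have hx' := delPt_val_left (v 2 / v 1)
  refine le_antisymm (planePoint_le h1 fun l => ?_) (loc_le hx hz.sub_const)
  fin_cases l
  · exact hx'.congr coord_zero_div_one (by simp [h])
  · exact hx'.1.one.congr (div_self (coord_ne_zero 1)) (div_self h1)
  · exact (delPt_val_right _).congr coord_two_div_one rfl

theorem planePoint_eq_pointP {v : Fin 3 → ℂ} (h : v 0 = 0) (h1 : v 1 = 0) (h2 : v 2 ≠ 0) :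
    planePoint v = loc (1 / (cw - cy ^ 2)) (cy / (cw - cy ^ 2)) := by
  have hx : HasVal (planePoint v) (1 / (cw - cy ^ 2)) 0 := by
    have := hasVal_planePoint_coord h2 0
    rwa [coord_zero_div_two, h, zero_div] at this
  have hy : HasVal (planePoint v) (cy / (cw - cy ^ 2)) 0 := by
    have := hasVal_planePoint_coord h2 1
    rwa [coord_one_div_two, h1, zero_div] at this
  refine le_antisymm (planePoint_le h2 fun l => ?_) (loc_le hx hy)
  fin_cases l
  · exact AI_pointP.hasVal_left.congr coord_zero_div_two (by simp [h])
  · exact AI_pointP.hasVal_right.congr coord_one_div_two (by simp [h1])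
  · exact AI_pointP.hasVal_left.1.one.congr (div_self (coord_ne_zero 2)) (div_self h2)

theorem pointP_eq : pointP = loc (1 / (cw - cy ^ 2)) (cy / (cw - cy ^ 2)) :=
  planePoint_eq_pointP rfl rfl one_ne_zero

theorem pointR_eq : pointR = loc cy cw := by
  have := planePoint_eq_affPt (v := ![1, 0, 0]) (by simp)
  simpa [affPt, pointR] using this

/-- The points of a plane curve in affine coordinates. -/
theorem mem_planeCurve_iff {F : Coord} {n : ℕ} (hF : F.IsHomogeneous n) {A : LocalSubring FF} :
    A ∈ planeCurve F ↔ (∃ a b, eval ![1, a, b - a ^ 2] F = 0 ∧ A = affPt a b) ∨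
      (∃ t, eval ![0, 1, t] F = 0 ∧ A = delPt t) ∨ (eval ![0, 0, 1] F = 0 ∧ A = pointP) := by
  constructor
  · rintro ⟨v, hv, h, rfl⟩
    by_cases h0 : v 0 = 0
    · by_cases h1 : v 1 = 0
      · have h2 : v 2 ≠ 0 := fun h2 => hv (by ext i; fin_cases i <;> assumption)
        rw [eval_of_isHomogeneous hF h2] at h
        refine Or.inr (Or.inr ⟨?_, by rw [planePoint_eq_pointP h0 h1 h2, pointP_eq]⟩)
        convert (mul_eq_zero.1 h).resolve_left (pow_ne_zero _ h2) using 2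
        congr 1
        ext i
        fin_cases i <;> simp [h0, h1, h2]
      · rw [eval_of_isHomogeneous hF h1] at h
        refine Or.inr (Or.inl ⟨_, ?_, planePoint_eq_delPt h0 h1⟩)
        convert (mul_eq_zero.1 h).resolve_left (pow_ne_zero _ h1) using 2
        congr 1
        ext i
        fin_cases i <;> simp [h0, h1]
    · rw [eval_of_isHomogeneous hF h0] at h
      refine Or.inl ⟨_, _, ?_, planePoint_eq_affPt h0⟩
      convert (mul_eq_zero.1 h).resolve_left (pow_ne_zero _ h0) using 2
      congr 1
      ext i
      fin_cases i <;> simp [h0]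
      field_simp
      ring
  · rintro (⟨a, b, h, rfl⟩ | ⟨t, h, rfl⟩ | ⟨h, rfl⟩)
    · refine ⟨_, fun h0 => ?_, h, ?_⟩
      · simpa using congrFun h0 0
      · rw [planePoint_eq_affPt (by simp)]
        simp
    · refine ⟨_, fun h0 => ?_, h, ?_⟩
      · simpa using congrFun h0 1
      · rw [planePoint_eq_delPt (by simp) (by simp)]
        simp
    · refine ⟨_, fun h0 => ?_, h, rfl⟩
      simpa using congrFun h0 2

theorem plane_eq_planeCurve : plane = planeCurve 0 := by
  ext A
  simp [plane, planeCurve]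

theorem mem_plane_iff {A : LocalSubring FF} :
    A ∈ plane ↔ (∃ a b, A = affPt a b) ∨ (∃ t, A = delPt t) ∨ A = pointP := by
  rw [plane_eq_planeCurve, mem_planeCurve_iff (isHomogeneous_zero _ _ 0)]
  simp

theorem affPt_mem_plane (a b : ℂ) : affPt a b ∈ plane := mem_plane_iff.2 (Or.inl ⟨a, b, rfl⟩)

theorem delPt_mem_plane (t : ℂ) : delPt t ∈ plane := mem_plane_iff.2 (Or.inr (Or.inl ⟨t, rfl⟩))

theorem pointP_mem_plane : pointP ∈ plane := mem_plane_iff.2 (Or.inr (Or.inr rfl))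

/-- Points in different strata (`x ≠ 0`; `x = 0 ≠ y`; `P`) are separated by `y/x`, `z/x` or `z/y`,
which has a finite value at one point while its inverse vanishes at the other. Within a stratum the
coordinates separate. -/
theorem isSurf_plane {k : IntermediateField ℂ FF} (hy : cy ∈ k) (hw : cw ∈ k) :
    IsSurf k plane where
  pts := by
    intro A hA
    rcases mem_plane_iff.1 hA with ⟨a, b, rfl⟩ | ⟨t, rfl⟩ | rfl
    · exact ⟨_, k.sub_mem hy (k.algebraMap_mem a), _, k.sub_mem hw (k.algebraMap_mem b),
        AI_affPt a b, rfl⟩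
    · exact ⟨_, k.div_mem k.one_mem hy, _,
        k.sub_mem (k.sub_mem (k.div_mem hw hy) hy) (k.algebraMap_mem t), AI_delPt t, rfl⟩
    · have hq := k.sub_mem hw (k.pow_mem hy 2)
      exact ⟨_, k.div_mem k.one_mem hq, _, k.div_mem hy hq, AI_pointP, pointP_eq⟩
  sep := by
    have hy0 := cy_ne_zero
    have hq0 := cw_sub_ne_zero
    have h1 : ∀ (a b t : ℂ) (C : LocalSubring FF), affPt a b ≤ C → delPt t ≤ C → False := by
      intro a b t C ha ht
      have e := ((affPt_val_cy a b).mono ha).mul ((delPt_val_left t).mono ht)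
      rw [mul_one_div_cancel hy0, mul_zero] at e
      exact one_ne_zero (e.1.one.unique e)
    have h2 : ∀ (a b : ℂ) (C : LocalSubring FF), affPt a b ≤ C → pointP ≤ C → False := by
      intro a b C ha hP
      rw [pointP_eq] at hP
      have e := (((affPt_val_cw a b).sub ((affPt_val_cy a b).pow 2)).mono ha).mul
        (AI_pointP.hasVal_left.mono hP)
      rw [mul_one_div_cancel hq0, mul_zero] at e
      exact one_ne_zero (e.1.one.unique e)
    have h3 : ∀ (t : ℂ) (C : LocalSubring FF), delPt t ≤ C → pointP ≤ C → False := by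
      intro t C ht hP
      rw [pointP_eq] at hP
      have e := ((delPt_val_right t).mono ht).mul (AI_pointP.hasVal_right.mono hP)
      rw [mul_zero, show (cw / cy - cy) * (cy / (cw - cy ^ 2)) = 1 by field_simp] at e
      exact one_ne_zero (e.1.one.unique e)
    intro A hA B hB C hAC hBC
    rcases mem_plane_iff.1 hA with ⟨a, b, rfl⟩ | ⟨t, rfl⟩ | rfl <;>
      rcases mem_plane_iff.1 hB with ⟨a', b', rfl⟩ | ⟨t', rfl⟩ | rfl
    · rw [((affPt_val_cy a b).mono hAC).unique ((affPt_val_cy a' b').mono hBC),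
        ((affPt_val_cw a b).mono hAC).unique ((affPt_val_cw a' b').mono hBC)]
    · exact (h1 _ _ _ _ hAC hBC).elim
    · exact (h2 _ _ _ hAC hBC).elim
    · exact (h1 _ _ _ _ hBC hAC).elim
    · rw [((delPt_val_right t).mono hAC).unique ((delPt_val_right t').mono hBC)]
    · exact (h3 _ _ hAC hBC).elim
    · exact (h2 _ _ _ hBC hAC).elim
    · exact (h3 _ _ hBC hAC).elim
    · rfl

/-! ### The cubic map as a linear map followed by an involution -/

/-- The linear substitution `x ↦ y`, `y ↦ z`, `z ↦ -x` on polynomials. -/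
def linPoly : Coord ≃ₐ[ℂ] Coord :=
  AlgEquiv.ofAlgHom (aeval ![X 1, X 2, -X 0]) (aeval ![-X 2, X 0, X 1])
    (by ext i; fin_cases i <;> simp) (by ext i; fin_cases i <;> simp)

/-- The linear substitution `x ↦ y`, `y ↦ z`, `z ↦ -x` on rational functions. -/
def lin : FF ≃+* FF := IsFractionRing.ringEquivOfRingEquiv linPoly.toRingEquiv

theorem lin_algebraMap (p : Coord) :
    lin (algebraMap Coord FF p) = algebraMap Coord FF (linPoly p) :=
  IsFractionRing.ringEquivOfRingEquiv_algebraMap _ p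

theorem lin_const (c : ℂ) : lin (κ c) = κ c := by
  rw [← algebraMap_C, lin_algebraMap, ← algebraMap_eq, AlgEquiv.commutes]

theorem linPoly_X (i : Fin 3) : linPoly (X i) = ![X 1, X 2, -X 0] i := by
  simp [linPoly]

theorem linPoly_isHomogeneous {n : ℕ} {F : Coord} (hF : F.IsHomogeneous n) :
    (linPoly F).IsHomogeneous n := by
  have h : ∀ i, (![X 1, X 2, -X 0] i : Coord).IsHomogeneous 1 := fun i => by
    fin_cases i
    exacts [isHomogeneous_X _ _, isHomogeneous_X _ _, (isHomogeneous_X _ _).neg]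
  have := hF.aeval _ h
  rwa [one_mul] at this

theorem linPoly_symm_isHomogeneous {n : ℕ} {F : Coord} (hF : F.IsHomogeneous n) :
    (linPoly.symm F).IsHomogeneous n := by
  have h : ∀ i, (![-X 2, X 0, X 1] i : Coord).IsHomogeneous 1 := fun i => by
    fin_cases i
    exacts [(isHomogeneous_X _ _).neg, isHomogeneous_X _ _, isHomogeneous_X _ _]
  have := hF.aeval _ h
  rwa [one_mul] at this

theorem eval_linPoly (v : Fin 3 → ℂ) (F : Coord) :
    eval ![-v 2, v 0, v 1] (linPoly F) = eval v F := by
  induction F using MvPolynomial.induction_on with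
  | C c => rw [← algebraMap_eq, AlgEquiv.commutes, algebraMap_eq, eval_C, eval_C]
  | add p q hp hq => simp [hp, hq]
  | mul_X p i hp =>
    rw [map_mul, map_mul, hp, map_mul, linPoly_X, eval_X]
    fin_cases i <;> simp

/-- The action on points of the linear substitution. -/
theorem planePoint_map_lin (v : Fin 3 → ℂ) :
    (planePoint v).map (lin : FF →+* FF) = planePoint ![-v 2, v 0, v 1] := by
  refine LocalSubring.ext ?_
  ext a
  rw [LocalSubring.map_toSubring, Subring.mem_map]
  constructor
  · rintro ⟨_, ⟨n, F, G, hF, hG, hv, rfl⟩, rfl⟩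
    refine ⟨n, _, _, linPoly_isHomogeneous hF, linPoly_isHomogeneous hG, ?_, ?_⟩
    · rwa [eval_linPoly]
    · rw [RingHom.coe_coe, map_div₀, lin_algebraMap, lin_algebraMap]
  · rintro ⟨n, F, G, hF, hG, hv, rfl⟩
    refine ⟨_, ⟨n, _, _, linPoly_symm_isHomogeneous hF, linPoly_symm_isHomogeneous hG, ?_, rfl⟩, ?_⟩
    · rwa [← eval_linPoly, AlgEquiv.apply_symm_apply]
    · rw [RingHom.coe_coe, map_div₀, lin_algebraMap, lin_algebraMap, AlgEquiv.apply_symm_apply,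
        AlgEquiv.apply_symm_apply]

theorem image_planeCurve_lin (F : Coord) :
    LocalSubring.map (lin : FF →+* FF) '' planeCurve F = planeCurve (linPoly F) := by
  ext A
  constructor
  · rintro ⟨_, ⟨v, hv, h, rfl⟩, rfl⟩
    refine ⟨_, fun h0 => hv ?_, ?_, planePoint_map_lin v⟩
    · ext i
      fin_cases i
      exacts [congrFun h0 1, congrFun h0 2, neg_eq_zero.1 (congrFun h0 0)]
    · rwa [eval_linPoly]
  · rintro ⟨v, hv, h, rfl⟩
    have hv' : ![-(![v 1, v 2, -v 0] : Fin 3 → ℂ) 2, (![v 1, v 2, -v 0] : Fin 3 → ℂ) 0,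
        (![v 1, v 2, -v 0] : Fin 3 → ℂ) 1] = v := by
      ext i
      fin_cases i <;> simp
    refine ⟨_, ⟨![v 1, v 2, -v 0], fun h0 => hv ?_, ?_, rfl⟩, ?_⟩
    · ext i
      fin_cases i
      exacts [neg_eq_zero.1 (congrFun h0 2), congrFun h0 0, congrFun h0 1]
    · rwa [← eval_linPoly, hv']
    · rw [planePoint_map_lin, hv']

theorem image_plane_lin : LocalSubring.map (lin : FF →+* FF) '' plane = plane := by
  rw [plane_eq_planeCurve, image_planeCurve_lin, map_zero]

theorem pullback_algebraMap (f : BirMap) (p : Coord) :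
    f.pullback (algebraMap Coord FF p) = algebraMap Coord FF (aeval f.toPoly p) :=
  IsLocalization.map_eq (M := nonZeroDivisors Coord) (T := nonZeroDivisors Coord)
    (nonZeroDivisors_le_comap_nonZeroDivisors_of_injective _ f.aeval_toPoly_injective) p

/-- The pullback of rational functions under the involution
`(x (x z + y ^ 2) : y (x z + y ^ 2) : - y ^ 2 z)`. -/
def invol : FF →+* FF := cubicMap.pullback.comp (lin : FF →+* FF)

theorem invol_algebraMap (p : Coord) :
    invol (algebraMap Coord FF p) = algebraMap Coord FF (aeval cubicMap.toPoly (linPoly p)) := by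
  rw [invol, RingHom.comp_apply, RingHom.coe_coe, lin_algebraMap, pullback_algebraMap]

theorem invol_const (c : ℂ) : invol (κ c) = κ c := by
  rw [← algebraMap_C, invol_algebraMap, ← algebraMap_eq, AlgEquiv.commutes, AlgHom.commutes]

/-- This is `f⁻¹ = σ ∘ L⁻¹`, with `lin` the pullback by `L⁻¹`. It is an identity of the chosen
polynomials, hence holds on all of `FF` and not only in degree `0`. -/
theorem cubicMap_symm_pullback : cubicMap.symm.pullback = (lin : FF →+* FF).comp invol := by
  refine IsFractionRing.ringHom_ext (A := Coord) fun p => ?_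
  rw [pullback_algebraMap, RingHom.comp_apply, invol_algebraMap, RingHom.coe_coe, lin_algebraMap]
  congr 1
  induction p using MvPolynomial.induction_on with
  | C c => simp only [← algebraMap_eq, AlgEquiv.commutes, AlgHom.commutes]
  | add p q hp hq => simp only [map_add, hp, hq]
  | mul_X p i hp =>
    simp only [map_mul, hp, aeval_X, linPoly_X]
    congr 1
    fin_cases i <;>
      simp [cubicMap, BirMap.symm, linPoly_X] <;> ring

theorem invol_coord (i : Fin 3) : invol (coord i) =
    ![coord 0 * (coord 0 * coord 2 + coord 1 ^ 2), coord 1 * (coord 0 * coord 2 + coord 1 ^ 2),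
      -(coord 1 ^ 2 * coord 2)] i := by
  rw [coord, invol_algebraMap, linPoly_X]
  fin_cases i <;> simp [cubicMap, coord]

theorem invol_cy : invol cy = cy := by
  have h := cw_ne_zero
  have hx := coord_ne_zero 0
  rw [cw] at h
  have h' := (div_ne_zero_iff.1 h).1
  rw [cy, map_div₀, invol_coord, invol_coord]
  simp only [Matrix.cons_val_zero, Matrix.cons_val_one]
  rw [mul_div_mul_right _ _ h']

/-- Computed through `z/x = w - y²`, whose pullback is read off from the homogeneous formulas. The
exponent `4` is the number of points blown up over `R`. -/
theorem invol_cw : invol cw = cy ^ 4 / cw := by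
  have h := cw_ne_zero
  have hx := coord_ne_zero 0
  rw [cw] at h
  have h' := (div_ne_zero_iff.1 h).1
  have hz : invol (cw - cy ^ 2) = -cy ^ 2 * (cw - cy ^ 2) / cw := by
    rw [← coord_two_div_zero, map_div₀, invol_coord, invol_coord, cy, cw]
    simp only [Matrix.cons_val_zero, Matrix.cons_val]
    field_simp
  have := cw_ne_zero
  rw [map_sub, map_pow, invol_cy, sub_eq_iff_eq_add] at hz
  rw [hz]
  field_simp
  ring

/-- The rational functions on which the pullback under the involution is an involution. -/
def invField : IntermediateField ℂ FF where
  carrier := {a | invol (invol a) = a}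
  mul_mem' := fun {a b} (ha : invol (invol a) = a) (hb : invol (invol b) = b) => by
    change invol (invol (a * b)) = _
    rw [map_mul, map_mul, ha, hb]
  add_mem' := fun {a b} (ha : invol (invol a) = a) (hb : invol (invol b) = b) => by
    change invol (invol (a + b)) = _
    rw [map_add, map_add, ha, hb]
  algebraMap_mem' := fun c => by
    change invol (invol (κ c)) = _
    rw [invol_const, invol_const]
  inv_mem' := fun a (ha : invol (invol a) = a) => by
    change invol (invol a⁻¹) = _
    rw [map_inv₀, map_inv₀, ha]

theorem mem_invField {a : FF} : a ∈ invField ↔ invol (invol a) = a := Iff.rfl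

theorem cy_mem : cy ∈ invField := by
  rw [mem_invField, invol_cy, invol_cy]

theorem cw_mem : cw ∈ invField := by
  have h := cw_ne_zero
  have h' := cy_ne_zero
  rw [mem_invField, invol_cw, map_div₀, map_pow, invol_cy, invol_cw]
  field_simp

/-- `invol` triples degrees, so its square is not the identity of `FF`. It is the identity on
`invField`, and a point is determined by local coordinates taken there. -/
theorem IsPt.map_invol_map_invol {A : LocalSubring FF} (hA : IsPt invField A) :
    (A.map invol).map invol = A := by
  obtain ⟨u, hu, v, hv, -, rfl⟩ := hA
  rw [loc_map invol invol_const, loc_map invol invol_const, mem_invField.1 hu, mem_invField.1 hv]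

theorem isSurf_plane_invField : IsSurf invField plane := isSurf_plane cy_mem cw_mem

/-! ### The points of the blown up plane and their images -/

/-- The point infinitely near to `R` of order `n` on the conic `C`. -/
def tower (n : ℕ) : LocalSubring FF := loc cy (cw / cy ^ n)

/-- The points of the affine part of the exceptional curve of `tower (n - 1)`; for `n = 0`, of the
line `y = 0`. -/
def excPt (n : ℕ) (c : ℂ) : LocalSubring FF := loc cy (cw / cy ^ n - κ c)

/-- The point at infinity of the exceptional curve of `tower n`. -/
def excInf (n : ℕ) : LocalSubring FF := loc (cw / cy ^ n) (cy ^ (n + 1) / cw)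

/-- The points of the affine part of the exceptional curve of `P`. -/
def conPt (c : ℂ) : LocalSubring FF := loc (cy / (cw - cy ^ 2)) (1 / cy - κ c)

/-- The point at infinity of the exceptional curve of `P`. -/
def conInf : LocalSubring FF := loc (1 / (cw - cy ^ 2)) cy

theorem tower_eq (n : ℕ) : tower n = excPt n 0 := by simp [tower, excPt]

theorem pointR_eq_tower : pointR = tower 0 := by simp [pointR_eq, tower]

theorem affPt_zero (b : ℂ) : affPt 0 b = excPt 0 b := by simp [affPt, excPt]

theorem AI_tower (n : ℕ) : AI cy (cw / cy ^ n) := by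
  refine AI_cy_cw.of_mem_adjoin (fun E h _ => h) fun E h h' => ?_
  have := E.mul_mem h' (pow_mem h n)
  rwa [div_mul_cancel₀ _ (pow_ne_zero n cy_ne_zero)] at this

theorem AI_excPt (n : ℕ) (c : ℂ) : AI cy (cw / cy ^ n - κ c) := by
  simpa using (AI_tower n).sub_const 0 c

theorem div_tower (n : ℕ) : cw / cy ^ n / cy = cw / cy ^ (n + 1) := by
  rw [div_div, pow_succ]

theorem tower_div (n : ℕ) : cy / (cw / cy ^ n) = cy ^ (n + 1) / cw := by
  rw [div_div_eq_mul_div, pow_succ']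

theorem AI_excInf (n : ℕ) : AI (cw / cy ^ n) (cy ^ (n + 1) / cw) := by
  rw [← tower_div]
  exact (AI_tower n).symm.div

theorem AI_pointP_symm : AI (cy / (cw - cy ^ 2)) (1 / (cw - cy ^ 2)) := AI_pointP.symm

theorem AI_conPt (c : ℂ) : AI (cy / (cw - cy ^ 2)) (1 / cy - κ c) := by
  have := AI_pointP_symm.div_sub c
  rwa [div_div_div_cancel_right₀ cw_sub_ne_zero] at this

theorem AI_conInf : AI (1 / (cw - cy ^ 2)) cy := by
  have := AI_pointP_symm.symm.div
  rwa [div_div_div_cancel_right₀ cw_sub_ne_zero, div_one] at this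

theorem mem_exceptional_tower {n : ℕ} {A : LocalSubring FF} :
    A ∈ exceptional (tower n) ↔ (∃ c, A = excPt (n + 1) c) ∨ A = excInf n := by
  rw [tower, (AI_tower n).mem_exceptional_iff, div_tower, tower_div]
  rfl

theorem mem_exceptional_pointP {A : LocalSubring FF} :
    A ∈ exceptional pointP ↔ (∃ c, A = conPt c) ∨ A = conInf := by
  rw [pointP_eq, loc_comm, AI_pointP_symm.mem_exceptional_iff,
    div_div_div_cancel_right₀ cw_sub_ne_zero, div_div_div_cancel_right₀ cw_sub_ne_zero, div_one]
  rfl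

theorem excPt_val_cy (n : ℕ) (c : ℂ) : HasVal (excPt n c) cy 0 := (AI_excPt n c).hasVal_left

theorem excPt_val (n : ℕ) (c : ℂ) : HasVal (excPt n c) (cw / cy ^ n) c :=
  (AI_excPt n c).hasVal_right.of_sub

/-- Since `w/yᵐ = yⁿ⁻ᵐ · (w/yⁿ)` and `y` vanishes; the factor `0 ^ (n - m)` covers both cases, being
`1` for `m = n`. -/
theorem excPt_val_of_le {n m : ℕ} (h : m ≤ n) (c : ℂ) :
    HasVal (excPt n c) (cw / cy ^ m) (0 ^ (n - m) * c) := by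
  have hy := cy_ne_zero
  refine (((excPt_val_cy n c).pow (n - m)).mul (excPt_val n c)).congr ?_ rfl
  rw [pow_sub₀ _ hy h]
  field_simp

theorem excInf_val_left (n : ℕ) : HasVal (excInf n) (cw / cy ^ n) 0 := (AI_excInf n).hasVal_left

theorem excInf_val_right (n : ℕ) : HasVal (excInf n) (cy ^ (n + 1) / cw) 0 :=
  (AI_excInf n).hasVal_right

theorem excInf_val_cy (n : ℕ) : HasVal (excInf n) cy 0 := by
  have hy := cy_ne_zero
  have hw := cw_ne_zero
  refine ((excInf_val_left n).mul (excInf_val_right n)).congr ?_ (by simp)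
  field_simp
  ring

theorem excInf_val_cw (n : ℕ) : HasVal (excInf n) cw 0 := by
  refine ((excInf_val_left n).mul ((excInf_val_cy n).pow n)).congr ?_ (by simp)
  rw [div_mul_cancel₀ _ (pow_ne_zero n cy_ne_zero)]

theorem conPt_val_left (c : ℂ) : HasVal (conPt c) (cy / (cw - cy ^ 2)) 0 :=
  (AI_conPt c).hasVal_left

theorem conPt_val_right (c : ℂ) : HasVal (conPt c) (1 / cy) c :=
  (AI_conPt c).hasVal_right.of_sub

theorem conInf_val_left : HasVal conInf (1 / (cw - cy ^ 2)) 0 := AI_conInf.hasVal_left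

theorem conInf_val_right : HasVal conInf cy 0 := AI_conInf.hasVal_right

theorem HasVal.ne {A B : LocalSubring FF} {a : FF} {c d : ℂ} (hA : HasVal A a c)
    (hB : HasVal B a d) (h : c ≠ d) : A ≠ B := by
  rintro rfl
  exact h (hA.unique hB)

theorem HasVal.ne_of_inv {A B : LocalSubring FF} {a : FF} {c : ℂ} (hA : HasVal A a c)
    (hB : HasVal B a⁻¹ 0) (h0 : a ≠ 0) : A ≠ B := by
  rintro rfl
  have := hA.mul hB
  rw [mul_inv_cancel₀ h0, mul_zero] at this
  exact one_ne_zero (this.1.one.unique this)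

theorem HasVal.ne_pointP {A : LocalSubring FF} {c d : ℂ} (h : HasVal A cy c)
    (h' : HasVal A cw d) : A ≠ pointP := by
  rw [pointP_eq]
  refine (h'.sub (h.pow 2)).ne_of_inv ?_ cw_sub_ne_zero
  rw [← one_div]
  exact AI_pointP.hasVal_left

theorem delPt_ne_pointP (t : ℂ) : delPt t ≠ pointP := by
  rw [pointP_eq]
  have hy := cy_ne_zero
  have h : cw / cy - cy = (cw - cy ^ 2) / cy := by field_simp
  refine (delPt_val_right t).ne_of_inv ?_ ?_
  · rw [h, inv_div]
    exact AI_pointP.hasVal_right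
  · rw [h]
    exact div_ne_zero cw_sub_ne_zero hy

theorem excPt_val_cw (n : ℕ) (c : ℂ) : HasVal (excPt n c) cw (0 ^ n * c) := by
  simpa using excPt_val_of_le (Nat.zero_le n) c

theorem excPt_ne_tower {n m : ℕ} {c : ℂ} (hc : c ≠ 0) (h : n ≤ m) : excPt n c ≠ tower m := by
  rw [tower_eq]
  exact (excPt_val n c).ne (excPt_val_of_le h 0) (by simpa using hc)

theorem excInf_ne_tower {n m : ℕ} (h : n < m) : excInf n ≠ tower m := by
  rw [tower_eq]
  refine ((excPt_val_of_le h 0).ne_of_inv ?_ ?_).symm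
  · rw [inv_div]
    exact excInf_val_right n
  · exact div_ne_zero cw_ne_zero (pow_ne_zero _ cy_ne_zero)

theorem affPt_ne_tower {a b : ℂ} (ha : a ≠ 0) (m : ℕ) : affPt a b ≠ tower m := by
  rw [tower_eq]
  exact (affPt_val_cy a b).ne (excPt_val_cy m 0) ha

theorem delPt_ne_tower (t : ℂ) (m : ℕ) : delPt t ≠ tower m := by
  rw [tower_eq]
  refine ((excPt_val_cy m 0).ne_of_inv ?_ cy_ne_zero).symm
  rw [← one_div]
  exact delPt_val_left t

/-- The plane blown up at the first `n` of the points `tower 0`, `tower 1`, …. -/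
def stage : ℕ → Set (LocalSubring FF)
  | 0 => plane
  | n + 1 => blowUp (stage n) (tower n)

theorem tower_mem_stage (n : ℕ) : tower n ∈ stage n := by
  cases n with
  | zero => exact mem_plane_iff.2 (Or.inl ⟨0, 0, by rw [affPt_zero, tower_eq]⟩)
  | succ n => exact Or.inr (mem_exceptional_tower.2 (Or.inl ⟨0, tower_eq _⟩))

theorem isSurf_stage (n : ℕ) : IsSurf invField (stage n) := by
  induction n with
  | zero => exact isSurf_plane_invField
  | succ n ih => exact ih.blowUp (tower_mem_stage n)

theorem mem_stage_iff {n : ℕ} {A : LocalSubring FF} : A ∈ stage n ↔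
    (A ∈ plane ∧ ∀ m < n, A ≠ tower m) ∨
    ∃ l < n, A ∈ exceptional (tower l) ∧ ∀ m < n, l < m → A ≠ tower m := by
  induction n with
  | zero => simp [stage]
  | succ n ih =>
    rw [stage, blowUp, Set.mem_union, Set.mem_sdiff, ih, Set.mem_singleton_iff]
    constructor
    · rintro (⟨⟨h1, h2⟩ | ⟨l, h1, h2, h3⟩, h⟩ | h)
      · refine Or.inl ⟨h1, fun m hm => ?_⟩
        rcases Nat.lt_succ_iff_lt_or_eq.1 hm with hm | rfl
        exacts [h2 m hm, h]
      · refine Or.inr ⟨l, by omega, h2, fun m hm hlm => ?_⟩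
        rcases Nat.lt_succ_iff_lt_or_eq.1 hm with hm | rfl
        exacts [h3 m hm hlm, h]
      · exact Or.inr ⟨n, by omega, h, fun m hm hlm => by omega⟩
    · rintro (⟨h1, h2⟩ | ⟨l, h1, h2, h3⟩)
      · exact Or.inl ⟨Or.inl ⟨h1, fun m hm => h2 m (by omega)⟩, h2 n (by omega)⟩
      · rcases Nat.lt_succ_iff_lt_or_eq.1 h1 with hl | rfl
        · exact Or.inl ⟨Or.inr ⟨l, hl, h2, fun m hm => h3 m (by omega)⟩, h3 n (by omega) hl⟩
        · exact Or.inr h2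

theorem affPt_mem_stage {a b : ℂ} (ha : a ≠ 0) (n : ℕ) : affPt a b ∈ stage n :=
  mem_stage_iff.2 (Or.inl ⟨affPt_mem_plane a b, fun m _ => affPt_ne_tower ha m⟩)

theorem delPt_mem_stage (t : ℂ) (n : ℕ) : delPt t ∈ stage n :=
  mem_stage_iff.2 (Or.inl ⟨delPt_mem_plane t, fun m _ => delPt_ne_tower t m⟩)

theorem pointP_mem_stage (n : ℕ) : pointP ∈ stage n :=
  mem_stage_iff.2 (Or.inl ⟨pointP_mem_plane, fun m _ => by
    rw [tower_eq]
    exact ((excPt_val_cy m 0).ne_pointP (excPt_val_cw m 0)).symm⟩)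

theorem excPt_mem_stage {n l : ℕ} {c : ℂ} (hn : l ≤ n) (hc : c ≠ 0 ∨ l = n) :
    excPt l c ∈ stage n := by
  rw [mem_stage_iff]
  have hne : ∀ m < n, l ≤ m → excPt l c ≠ tower m := fun m hm hlm =>
    excPt_ne_tower (hc.resolve_right (by omega)) hlm
  cases l with
  | zero =>
    refine Or.inl ⟨?_, fun m hm => hne m hm (Nat.zero_le m)⟩
    rw [← affPt_zero]
    exact affPt_mem_plane 0 c
  | succ l => exact Or.inr ⟨l, by omega, mem_exceptional_tower.2 (Or.inl ⟨c, rfl⟩), hne⟩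

theorem excInf_mem_stage {n l : ℕ} (hn : l < n) : excInf l ∈ stage n :=
  mem_stage_iff.2 (Or.inr ⟨l, hn, mem_exceptional_tower.2 (Or.inr rfl), fun _ _ h =>
    excInf_ne_tower h⟩)

/-- The list `R, S, U, Y, P`. -/
def baseList : List (LocalSubring FF) := [tower 0, tower 1, tower 2, tower 3, pointP]

/-- The plane blown up at `R, S, U, Y, P`. -/
def resolved : Set (LocalSubring FF) := Bl plane baseList

theorem isPointList_baseList : IsPointList plane baseList :=
  ⟨tower_mem_stage 0, tower_mem_stage 1, tower_mem_stage 2, tower_mem_stage 3,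
    pointP_mem_stage 4, trivial⟩

theorem isSurf_resolved : IsSurf invField resolved := isSurf_plane_invField.bl isPointList_baseList

theorem affPt_mem {a b : ℂ} (ha : a ≠ 0) : affPt a b ∈ resolved :=
  Or.inl ⟨affPt_mem_stage ha 4, (affPt_val_cy a b).ne_pointP (affPt_val_cw a b)⟩

theorem delPt_mem (t : ℂ) : delPt t ∈ resolved := Or.inl ⟨delPt_mem_stage t 4, delPt_ne_pointP t⟩

theorem excPt_mem {n : ℕ} {c : ℂ} (hn : n ≤ 4) (hc : c ≠ 0 ∨ n = 4) : excPt n c ∈ resolved :=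
  Or.inl ⟨excPt_mem_stage hn hc, (excPt_val_cy n c).ne_pointP (excPt_val_cw n c)⟩

theorem excInf_mem {n : ℕ} (hn : n ≤ 3) : excInf n ∈ resolved :=
  Or.inl ⟨excInf_mem_stage (n := 4) (by omega), (excInf_val_cy n).ne_pointP (excInf_val_cw n)⟩

theorem conPt_mem (c : ℂ) : conPt c ∈ resolved :=
  Or.inr (mem_exceptional_pointP.2 (Or.inl ⟨c, rfl⟩))

theorem conInf_mem : conInf ∈ resolved := Or.inr (mem_exceptional_pointP.2 (Or.inr rfl))

/-- Explicit coordinates for every point of the resolved surface. `excPt n 0` with `n ≤ 3` is absent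
because it is the blown up point `tower n`. -/
theorem cases_of_mem_resolved {A : LocalSubring FF} (hA : A ∈ resolved) :
    (∃ a b, a ≠ 0 ∧ A = affPt a b) ∨ (∃ t, A = delPt t) ∨
    (∃ n c, n ≤ 4 ∧ (c ≠ 0 ∨ n = 4) ∧ A = excPt n c) ∨ (∃ n ≤ 3, A = excInf n) ∨
    (∃ c, A = conPt c) ∨ A = conInf := by
  rcases hA with ⟨hA, hP⟩ | hA
  · rcases mem_stage_iff.1 (show A ∈ stage 4 from hA) with ⟨h1, h2⟩ | ⟨l, h1, h2, h3⟩
    · rcases mem_plane_iff.1 h1 with ⟨a, b, rfl⟩ | ⟨t, rfl⟩ | rfl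
      · by_cases ha : a = 0
        · subst ha
          rw [affPt_zero] at h2 ⊢
          refine Or.inr (Or.inr (Or.inl ⟨0, b, by omega, Or.inl ?_, rfl⟩))
          rintro rfl
          exact h2 0 (by omega) (tower_eq 0).symm
        · exact Or.inl ⟨a, b, ha, rfl⟩
      · exact Or.inr (Or.inl ⟨t, rfl⟩)
      · exact absurd rfl hP
    · rcases mem_exceptional_tower.1 h2 with ⟨c, rfl⟩ | rfl
      · refine Or.inr (Or.inr (Or.inl ⟨l + 1, c, by omega, ?_, rfl⟩))
        by_contra hcon
        push Not at hcon
        rw [hcon.1] at h3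
        exact h3 (l + 1) (by omega) (by omega) (tower_eq _).symm
      · exact Or.inr (Or.inr (Or.inr (Or.inl ⟨l, by omega, rfl⟩)))
  · rcases mem_exceptional_pointP.1 hA with ⟨c, rfl⟩ | rfl
    · exact Or.inr (Or.inr (Or.inr (Or.inr (Or.inl ⟨c, rfl⟩))))
    · exact Or.inr (Or.inr (Or.inr (Or.inr (Or.inr rfl))))

/-! ### The lift of the involution -/

theorem loc_map_invol_le {u v : FF} {A : LocalSubring FF} (hu : HasVal A (invol u) 0)
    (hv : HasVal A (invol v) 0) : (loc u v).map invol ≤ A := by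
  rw [loc_map invol invol_const]
  exact loc_le hu hv

theorem HasVal.invol_sub {A : LocalSubring FF} {a : FF} {c : ℂ} (h : HasVal A (invol a) c) :
    HasVal A (invol (a - κ c)) 0 := by
  rw [map_sub, invol_const]
  exact h.sub_const

/-- The symmetry `n ↔ 4 - n` behind the reversal of the chain of curves over `R`. -/
theorem invol_cw_div (n : ℕ) (hn : n ≤ 4) : invol (cw / cy ^ n) = (cw / cy ^ (4 - n))⁻¹ := by
  have hy := cy_ne_zero
  have hw := cw_ne_zero
  rw [map_div₀, map_pow, invol_cy, invol_cw, pow_sub₀ _ hy hn]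
  field_simp

theorem invol_cw_sub : invol (cw - cy ^ 2) = -(cy ^ 2 * (cw - cy ^ 2)) / cw := by
  have hw := cw_ne_zero
  rw [map_sub, map_pow, invol_cy, invol_cw]
  field_simp
  ring

theorem affPt_map_le {a b : ℂ} (hb : b ≠ 0) :
    (affPt a (a ^ 4 / b)).map invol ≤ affPt a b := by
  refine loc_map_invol_le (HasVal.invol_sub ?_) (HasVal.invol_sub ?_)
  · rw [invol_cy]
    exact affPt_val_cy a b
  · rw [invol_cw]
    exact ((affPt_val_cy a b).pow 4).div (affPt_val_cw a b) hb

theorem invol_conic_coord : invol (cy / (cw - cy ^ 2)) = -(cw / (cy * (cw - cy ^ 2))) := by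
  have hy := cy_ne_zero
  have hw := cw_ne_zero
  have hq := cw_sub_ne_zero
  rw [map_div₀, invol_cy, invol_cw_sub]
  field_simp

theorem invol_one_div_cy : invol (1 / cy) = 1 / cy := by
  rw [map_div₀, map_one, invol_cy]

/-- Where `w = 0`, the pullback of `y/z` vanishes while `x/y` is preserved: the conic is contracted
to `P`, and its points are told apart by their directions there. -/
theorem conPt_map_le_affPt {a : ℂ} (ha : a ≠ 0) : (conPt a⁻¹).map invol ≤ affPt a 0 := by
  have hy := affPt_val_cy a 0
  have hw := affPt_val_cw a 0
  refine loc_map_invol_le ?_ (HasVal.invol_sub ?_)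
  · rw [invol_conic_coord]
    refine (hw.div (hy.mul (hw.sub (hy.pow 2))) ?_).neg.congr rfl (by simp)
    simpa using ha
  · rw [invol_one_div_cy, one_div]
    exact hy.inv ha

theorem affPt_map_le_conPt {c : ℂ} (hc : c ≠ 0) : (affPt c⁻¹ 0).map invol ≤ conPt c := by
  have hy : HasVal (conPt c) cy c⁻¹ := by simpa using (conPt_val_right c).inv hc
  have hu := conPt_val_left c
  have hy0 := cy_ne_zero
  have hw0 := cw_ne_zero
  have hq0 := cw_sub_ne_zero
  -- `w` has a pole here, so `y⁴/w` is evaluated after dividing numerator and denominator by `w -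
  -- y²`; the denominator then has value `1`.
  have h1 : cy * (cy / (cw - cy ^ 2)) + 1 = cw / (cw - cy ^ 2) := by
    field_simp
    ring
  refine loc_map_invol_le (HasVal.invol_sub ?_) (HasVal.invol_sub ?_)
  · rwa [invol_cy]
  · rw [invol_cw]
    refine (((hy.pow 3).mul hu).div ((hy.mul hu).add hu.1.one) (by simp)).congr ?_ (by simp)
    rw [h1]
    field_simp

theorem conPt_zero_map_le : (conPt 0).map invol ≤ conPt 0 := by
  have hy0 := cy_ne_zero
  have hq0 := cw_sub_ne_zero
  refine loc_map_invol_le ?_ (HasVal.invol_sub ?_)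
  · rw [invol_conic_coord]
    refine ((conPt_val_left 0).add (conPt_val_right 0)).neg.congr ?_ (by simp)
    field_simp
    ring
  · rw [invol_one_div_cy]
    exact conPt_val_right 0

/-- The point where the conic meets the last exceptional curve over `R` is exchanged with the point
where the line `y = 0` meets the exceptional curve of `P`. -/
theorem excPt_map_le_conInf : (excPt 4 0).map invol ≤ conInf := by
  have hy := conInf_val_right
  have hq := conInf_val_left
  have hw0 := cw_ne_zero
  have hq0 := cw_sub_ne_zero
  have h1 : 1 + 1 / (cw - cy ^ 2) * cy ^ 2 = cw / (cw - cy ^ 2) := by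
    field_simp
    ring
  refine loc_map_invol_le ?_ (HasVal.invol_sub ?_)
  · rwa [invol_cy]
  · rw [invol_cw_div 4 le_rfl]
    refine (hq.div (hq.1.one.add (hq.mul (hy.pow 2))) (by simp)).congr ?_ (by simp)
    rw [h1]
    field_simp
    simp

theorem conInf_map_le : conInf.map invol ≤ excPt 4 0 := by
  have hy := excPt_val_cy 4 0
  have hr := excPt_val 4 0
  have hy0 := cy_ne_zero
  have hw0 := cw_ne_zero
  have hq0 := cw_sub_ne_zero
  have h1 : 1 - cw / cy ^ 4 * cy ^ 2 = -(cw - cy ^ 2) / cy ^ 2 := by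
    field_simp
    ring
  refine loc_map_invol_le ?_ ?_
  · rw [map_div₀, map_one, invol_cw_sub]
    refine (hr.div (hr.1.one.sub (hr.mul (hy.pow 2))) (by simp)).congr ?_ (by simp)
    rw [h1]
    field_simp
  · rwa [invol_cy]

theorem delPt_map_le (t : ℂ) : (delPt (-t)).map invol ≤ delPt t := by
  have hs := delPt_val_left t
  have hm := delPt_val_right t
  have hy0 := cy_ne_zero
  have hw0 := cw_ne_zero
  have h1 : 1 / cy * (cw / cy - cy) + 1 = cw / cy ^ 2 := by
    field_simp
    ring
  refine loc_map_invol_le ?_ (HasVal.invol_sub ?_)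
  · rwa [invol_one_div_cy]
  · rw [map_sub, map_div₀, invol_cy, invol_cw]
    refine (hm.div ((hs.mul hm).add hs.1.one) (by simp)).neg.congr ?_ (by simp)
    rw [h1]
    field_simp
    ring

theorem excPt_map_le {n : ℕ} {c : ℂ} (hn : n ≤ 4) (hc : c ≠ 0) :
    (excPt (4 - n) c⁻¹).map invol ≤ excPt n c := by
  refine loc_map_invol_le ?_ (HasVal.invol_sub ?_)
  · rw [invol_cy]
    exact excPt_val_cy n c
  · rw [invol_cw_div _ (by omega), show 4 - (4 - n) = n by omega]
    exact (excPt_val n c).inv hc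

/-- `excInf n` is the crossing point of two neighbouring curves of the chain. Reversing the chain
interchanges its two local coordinates `w/yⁿ` and `yⁿ⁺¹/w`. -/
theorem excInf_map_le {n : ℕ} (hn : n ≤ 3) : (excInf (3 - n)).map invol ≤ excInf n := by
  refine loc_map_invol_le ?_ ?_
  · rw [invol_cw_div _ (by omega), inv_div, show 4 - (3 - n) = n + 1 by omega]
    exact excInf_val_right n
  · rw [← inv_div, map_inv₀, invol_cw_div _ (by omega), inv_inv,
      show 4 - (3 - n + 1) = n by omega]
    exact excInf_val_left n

theorem exists_map_invol_le {A : LocalSubring FF} (hA : A ∈ resolved) :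
    ∃ B ∈ resolved, B.map invol ≤ A := by
  rcases cases_of_mem_resolved hA with ⟨a, b, ha, rfl⟩ | ⟨t, rfl⟩ | ⟨n, c, hn, hc, rfl⟩ |
    ⟨n, hn, rfl⟩ | ⟨c, rfl⟩ | rfl
  · by_cases hb : b = 0
    · subst hb
      exact ⟨_, conPt_mem _, conPt_map_le_affPt ha⟩
    · exact ⟨_, affPt_mem ha, affPt_map_le hb⟩
  · exact ⟨_, delPt_mem _, delPt_map_le t⟩
  · by_cases h : c = 0
    · obtain rfl := hc.resolve_left (not_not.2 h)
      subst h
      exact ⟨_, conInf_mem, conInf_map_le⟩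
    · exact ⟨_, excPt_mem (by omega) (Or.inl (inv_ne_zero h)), excPt_map_le hn h⟩
  · exact ⟨_, excInf_mem (by omega), excInf_map_le hn⟩
  · by_cases hc : c = 0
    · subst hc
      exact ⟨_, conPt_mem _, conPt_zero_map_le⟩
    · exact ⟨_, affPt_mem (inv_ne_zero hc), affPt_map_le_conPt hc⟩
  · exact ⟨_, excPt_mem le_rfl (Or.inr rfl), excPt_map_le_conInf⟩

theorem map_invol_map_invol {A : LocalSubring FF} (hA : A ∈ resolved) :
    (A.map invol).map invol = A := (isSurf_resolved.pts A hA).map_invol_map_invol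

/-- A point whose transform is dominated by a point is the image of the latter. -/
theorem map_invol_eq_of_le {A B : LocalSubring FF} (hA : A ∈ resolved) (hB : B ∈ resolved)
    (h : B.map invol ≤ A) : A.map invol = B := by
  obtain ⟨B', hB', h'⟩ := exists_map_invol_le hB
  have h1 := (map_le_map_iff invol).2 h'
  rw [map_invol_map_invol hB'] at h1
  -- Applying the involution twice gives `B' ≤ A`, which on a separated surface is an equality;
  -- regularity thus yields an isomorphism of local rings.
  obtain rfl := isSurf_resolved.eq_of_le hB' hA (h1.trans h)
  exact le_antisymm h' ((map_le_map_iff invol).1 (by rwa [map_invol_map_invol hA]))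

theorem map_invol_mem {A : LocalSubring FF} (hA : A ∈ resolved) : A.map invol ∈ resolved := by
  obtain ⟨B, hB, h⟩ := exists_map_invol_le hA
  rwa [map_invol_eq_of_le hA hB h]

open Filter Topology

/-! ### Regularity and indeterminacy -/

theorem exists_le_of_mem_Bl {X : Set (LocalSubring FF)} {l : List (LocalSubring FF)}
    (hl : IsPointList X l) {A : LocalSubring FF} (hA : A ∈ Bl X l) : ∃ B ∈ X, B ≤ A := by
  induction l generalizing X with
  | nil => exact ⟨A, hA, le_rfl⟩
  | cons B l ih =>
    obtain ⟨D, hD | hD, hDA⟩ := ih hl.2 hA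
    · exact ⟨D, hD.1, hDA⟩
    · exact ⟨B, hl.1, (le_of_mem_exceptional hD).trans hDA⟩

/-- The involution is regular on the blown up plane. -/
theorem exists_plane_map_invol_le {A : LocalSubring FF} (hA : A ∈ resolved) :
    ∃ B ∈ plane, B.map invol ≤ A := by
  obtain ⟨B, hB, h⟩ := exists_le_of_mem_Bl isPointList_baseList (map_invol_mem hA)
  refine ⟨B, hB, ?_⟩
  have := (map_le_map_iff invol).2 h
  rwa [map_invol_map_invol hA] at this

theorem tower_le_excPt {m n : ℕ} (h : m < n) (c : ℂ) : tower m ≤ excPt n c :=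
  loc_le (excPt_val_cy n c)
    ((excPt_val_of_le h.le c).congr rfl (by rw [zero_pow (by omega), zero_mul]))

theorem pointP_le_conPt (c : ℂ) : pointP ≤ conPt c :=
  le_of_mem_exceptional (mem_exceptional_pointP.2 (Or.inl ⟨c, rfl⟩))

theorem excPt_ne_excPt (n : ℕ) {c d : ℂ} (h : c ≠ d) : excPt n c ≠ excPt n d :=
  (excPt_val n c).ne (excPt_val n d) h

/-- All points `excPt 4 c⁻¹` dominate `tower m`, so an image of `tower m` would be the image of each
of them; but these images are the distinct points `excPt 0 c` of the line `y = 0`. -/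
theorem not_map_invol_le_tower {W : Set (LocalSubring FF)} (hW : IsSurf invField W)
    (h : ∀ c, c ≠ 0 → excPt 0 c ∈ W) {m : ℕ} (hm : m ≤ 3) {B : LocalSubring FF} (hB : B ∈ W) : ¬ B.map invol ≤ tower m := by
  intro hle
  have key : ∀ c, c ≠ 0 → B = excPt 0 c := fun c hc => by
    have h1 := excPt_map_le (n := 4) le_rfl (inv_ne_zero hc)
    rw [inv_inv] at h1
    exact hW.image_unique hB (h c hc) (hle.trans (tower_le_excPt (n := 4) (by omega) c⁻¹)) h1
  exact excPt_ne_excPt 0 (by norm_num : (1 : ℂ) ≠ 2) ((key 1 one_ne_zero).symm.trans (key 2 two_ne_zero))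

/-- The same argument with the exceptional curve of `P`, whose points `conPt a⁻¹` go to distinct
points of the conic. -/
theorem not_map_invol_le_pointP {W : Set (LocalSubring FF)} (hW : IsSurf invField W)
    (h : ∀ a, a ≠ 0 → affPt a 0 ∈ W) {B : LocalSubring FF} (hB : B ∈ W) : ¬ B.map invol ≤ pointP := by
  intro hle
  have key : ∀ a, a ≠ 0 → B = affPt a 0 := fun a ha => by
    have h1 := affPt_map_le_conPt (inv_ne_zero ha)
    rw [inv_inv] at h1
    exact hW.image_unique hB (h a ha) (hle.trans (pointP_le_conPt a⁻¹)) h1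
  exact (affPt_val_cy 1 0).ne (affPt_val_cy 2 0) (by norm_num)
    ((key 1 one_ne_zero).symm.trans (key 2 two_ne_zero))

theorem not_map_invol_le_of_mem_baseList {A : LocalSubring FF} (hA : A ∈ baseList)
    {B : LocalSubring FF} (hB : B ∈ plane) : ¬ B.map invol ≤ A := by
  have h1 : ∀ m ≤ 3, ¬ B.map invol ≤ tower m := fun m hm =>
    not_map_invol_le_tower isSurf_plane_invField
      (fun c _ => by rw [← affPt_zero]; exact affPt_mem_plane 0 c) hm hB
  have h2 := not_map_invol_le_pointP isSurf_plane_invField (fun a _ => affPt_mem_plane a 0) hB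
  simp only [baseList, List.mem_cons, List.not_mem_nil, or_false] at hA
  rcases hA with rfl | rfl | rfl | rfl | rfl
  exacts [h1 0 (by omega), h1 1 (by omega), h1 2 (by omega), h1 3 (by omega), h2]

theorem notMem_resolved_of_mem_baseList {A : LocalSubring FF} (hA : A ∈ baseList) :
    A ∉ resolved := fun h => by
  obtain ⟨B, hB, hle⟩ := exists_plane_map_invol_le h
  exact not_map_invol_le_of_mem_baseList hA hB hle

/-! ### Transport by the linear map -/

/-- The action of the linear map on points. -/
def linMap : LocalSubring FF → LocalSubring FF := LocalSubring.map (lin : FF →+* FF)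

theorem linMap_injective : Function.Injective linMap := map_injective _

theorem linMap_loc (u v : FF) : linMap (loc u v) = loc (lin u) (lin v) :=
  loc_map (lin : FF →+* FF) lin_const u v

theorem AI.lin {u v : FF} (h : AI u v) : AI (lin u) (lin v) := by
  have := AlgebraicIndependent.map' (f := AlgHom.mk (Cremona.lin : FF →+* FF) lin_const) h
    Cremona.lin.injective
  rwa [show ⇑(AlgHom.mk (Cremona.lin : FF →+* FF) lin_const) ∘ ![u, v] =
    ![Cremona.lin u, Cremona.lin v] by ext i; fin_cases i <;> rfl] at this

/-- Read off from the description by local coordinates, as `lin` fixes constants and respects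
quotients. -/
theorem exceptional_linMap {k : Set FF} {A : LocalSubring FF} (hA : IsPt k A) :
    exceptional (linMap A) = linMap '' exceptional A := by
  obtain ⟨u, -, v, -, h, rfl⟩ := hA
  ext B
  rw [linMap_loc, h.lin.mem_exceptional_iff, Set.mem_image]
  simp only [h.mem_exceptional_iff]
  constructor
  · rintro (⟨c, rfl⟩ | rfl)
    · exact ⟨_, Or.inl ⟨c, rfl⟩, by rw [linMap_loc, map_sub, map_div₀, lin_const]⟩
    · exact ⟨_, Or.inr rfl, by rw [linMap_loc, map_div₀]⟩
  · rintro ⟨_, ⟨c, rfl⟩ | rfl, rfl⟩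
    · exact Or.inl ⟨c, by rw [linMap_loc, map_sub, map_div₀, lin_const]⟩
    · exact Or.inr (by rw [linMap_loc, map_div₀])

theorem blowUp_linMap {k : Set FF} {X : Set (LocalSubring FF)} {A : LocalSubring FF}
    (hA : IsPt k A) : blowUp (linMap '' X) (linMap A) = linMap '' blowUp X A := by
  rw [blowUp, blowUp, exceptional_linMap hA, Set.image_union, Set.image_sdiff linMap_injective,
    Set.image_singleton]

theorem Bl_linMap {k : IntermediateField ℂ FF} {X : Set (LocalSubring FF)} (hX : IsSurf k X)
    {l : List (LocalSubring FF)} (hl : IsPointList X l) :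
    IsPointList (linMap '' X) (l.map linMap) ∧
      Bl (linMap '' X) (l.map linMap) = linMap '' Bl X l := by
  induction l generalizing X with
  | nil => exact ⟨trivial, rfl⟩
  | cons A l ih =>
    obtain ⟨h1, h2⟩ := ih (hX.blowUp hl.1) hl.2
    rw [← blowUp_linMap (hX.pts A hl.1)] at h1 h2
    exact ⟨⟨⟨A, hl.1, rfl⟩, h1⟩, h2⟩

theorem image_plane_linMap : linMap '' plane = plane := image_plane_lin

theorem mapsTo_linMap_iff {A B : LocalSubring FF} :
    cubicMap.MapsTo A (linMap B) ↔ B.map invol ≤ A := by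
  rw [BirMap.MapsTo, linMap, localSubring_map_map, invol]

/-- With `mapsTo_linMap_iff`, the regularity of `f` at `A` and that of `f⁻¹` at `L A` become the
same condition on `σ`. -/
theorem symm_mapsTo_linMap_iff {A B : LocalSubring FF} :
    cubicMap.symm.MapsTo (linMap A) B ↔ B.map invol ≤ A := by
  rw [BirMap.MapsTo, linMap, cubicMap_symm_pullback, ← localSubring_map_map, map_le_map_iff]

theorem regularAt_linMap_iff {W : Set (LocalSubring FF)} {A : LocalSubring FF} :
    cubicMap.RegularAt (linMap '' W) A ↔ ∃ B ∈ W, B.map invol ≤ A := by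
  simp only [BirMap.RegularAt, Set.exists_mem_image, mapsTo_linMap_iff]

theorem regularAt_plane_iff {A : LocalSubring FF} :
    cubicMap.RegularAt plane A ↔ ∃ B ∈ plane, B.map invol ≤ A := by
  rw [← regularAt_linMap_iff, image_plane_linMap]

theorem symm_regularAt_plane_iff {A : LocalSubring FF} :
    cubicMap.symm.RegularAt plane (linMap A) ↔ ∃ B ∈ plane, B.map invol ≤ A := by
  simp only [BirMap.RegularAt, symm_mapsTo_linMap_iff]

theorem image_linMap (W D : Set (LocalSubring FF)) :
    cubicMap.image (linMap '' W) D = linMap '' {B | B ∈ W ∧ ∃ A ∈ D, B.map invol ≤ A} := by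
  ext B
  constructor
  · rintro ⟨⟨B, hB, rfl⟩, A, hA, h⟩
    exact ⟨B, ⟨hB, A, hA, mapsTo_linMap_iff.1 h⟩, rfl⟩
  · rintro ⟨B, ⟨hB, A, hA, h⟩, rfl⟩
    exact ⟨⟨B, hB, rfl⟩, A, hA, mapsTo_linMap_iff.2 h⟩

theorem linMap_tower_zero : linMap (tower 0) = pointQ := by
  rw [← pointR_eq_tower, linMap, pointR, planePoint_map_lin, pointQ]
  simp

theorem linMap_pointP : linMap pointP = pointR := by
  rw [linMap, pointP, planePoint_map_lin, pointR, planePoint_eq_affPt (by simp),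
    planePoint_eq_affPt (by simp)]
  simp

theorem image_lineΔ'' : linMap '' lineΔ'' = lineΔ := by
  rw [linMap, lineΔ'', image_planeCurve_lin, linPoly_X]
  simp [planeCurve, lineΔ]

theorem image_lineΔ' : linMap '' lineΔ' = lineΔ'' := by
  rw [linMap, lineΔ', image_planeCurve_lin, linPoly_X]
  rfl

theorem image_conicC : linMap '' conicC = conicC' := by
  rw [linMap, conicC, image_planeCurve_lin, conicC']
  congr 1
  simp only [map_add, map_mul, map_pow, linPoly_X]
  simp
  ring

theorem Bl_plane_linMap {l : List (LocalSubring FF)} (hl : IsPointList plane l) :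
    Bl plane (l.map linMap) = linMap '' Bl plane l := by
  have := (Bl_linMap isSurf_plane_invField hl).2
  rwa [image_plane_linMap] at this

/-! ### Zariski topology and curves -/

/-- A subbasic open set given by a function in the range of `φ` pulls back to a subbasic one; for
any other function the preimage is empty, so `φ` need not be surjective. -/
theorem continuous_localSubring_map (φ : FF →+* FF) :
    Continuous (LocalSubring.map φ) := by
  refine continuous_generateFrom_iff.2 ?_
  rintro _ ⟨h, rfl⟩
  by_cases hh : ∃ a, φ a = h
  · obtain ⟨a, rfl⟩ := hh
    refine TopologicalSpace.isOpen_generateFrom_of_mem ⟨a, ?_⟩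
    ext A
    exact mem_map_iff φ
  · convert isOpen_empty
    refine Set.eq_empty_of_forall_notMem fun A hA => hh ?_
    obtain ⟨a, -, ha⟩ := hA
    exact ⟨a, ha⟩

/-- The action of the linear map on points, as a homeomorphism. -/
def linHomeo : LocalSubring FF ≃ₜ LocalSubring FF where
  toFun := linMap
  invFun := LocalSubring.map (lin.symm : FF →+* FF)
  left_inv A := by
    rw [linMap, localSubring_map_map]
    refine LocalSubring.ext ?_
    ext a
    simp
  right_inv A := by
    rw [linMap, localSubring_map_map]
    refine LocalSubring.ext ?_
    ext a
    simp
  continuous_toFun := continuous_localSubring_map _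
  continuous_invFun := continuous_localSubring_map _

theorem linMap_mem_closure_iff {D : Set (LocalSubring FF)} {A : LocalSubring FF} :
    linMap A ∈ closure (linMap '' D) ↔ A ∈ closure D := by
  have h : linMap '' closure D = closure (linMap '' D) := linHomeo.image_closure D
  rw [← h, linMap_injective.mem_set_image]

theorem linMap_mem_strictTransform_iff {S D : Set (LocalSubring FF)} {A : LocalSubring FF} :
    linMap A ∈ strictTransform (linMap '' S) (linMap '' D) ↔ A ∈ strictTransform S D := by
  rw [strictTransform, strictTransform, ← Set.image_inter linMap_injective, Set.mem_inter_iff,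
    Set.mem_inter_iff, linMap_injective.mem_set_image, linMap_mem_closure_iff]

/-- The points of the line `v = 0` depend continuously on their coordinate, for the cofinite
topology. -/
theorem AI.tendsto_loc {u v : FF} (h : AI u v) (c₀ : ℂ) :
    Tendsto (fun c => loc (u - κ c) v) cofinite (𝓝 (loc (u - κ c₀) v)) := by
  refine TopologicalSpace.tendsto_nhds_generateFrom_iff.2 ?_
  rintro _ ⟨_, rfl⟩ ⟨p, q, h0, h1, rfl⟩
  -- `Q` is the restriction of the denominator to the line `v = 0`. It is nonzero at `c₀`, hence
  -- vanishes at finitely many points only, and elsewhere the function stays regular.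
  let Q : Polynomial ℂ := aeval ![Polynomial.X - Polynomial.C c₀, 0] q
  have hQ : ∀ c, Q.eval c = eval ![c - c₀, 0] q := fun c => by
    have := congrArg (fun f : MvPolynomial (Fin 2) ℂ →ₐ[ℂ] ℂ => f q)
      (comp_aeval (R := ℂ) ![Polynomial.X - Polynomial.C c₀, 0] (Polynomial.aeval c))
    simp only [AlgHom.comp_apply] at this
    rw [← Polynomial.coe_aeval_eq_eval]
    refine this.trans ?_
    rw [← coe_aeval_eq_eval, show (fun i => Polynomial.aeval c
      ((![Polynomial.X - Polynomial.C c₀, 0] : Fin 2 → Polynomial ℂ) i)) = ![c - c₀, 0] by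
        ext i; fin_cases i <;> simp]
    rfl
  have hQ0 : Q ≠ 0 := by
    intro hz
    have := hQ c₀
    rw [hz, Polynomial.eval_zero, sub_self] at this
    refine h0 ?_
    rw [this]
    congr 2
    ext i
    fin_cases i <;> rfl
  have hfin : {c | Q.eval c = 0}.Finite := by
    refine (Q.roots.toFinset.finite_toSet).subset fun c hc => ?_
    simpa [hQ0] using hc
  rw [mem_cofinite]
  refine hfin.subset fun c hc => ?_
  by_contra hne
  refine hc ?_
  have hne' : eval ![c - c₀, 0] q ≠ 0 := by
    rw [← hQ]
    exact hne
  have hc' : AI (u - κ c) v := by simpa using h.sub_const c 0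
  have hval := fun p => HasVal.aeval (A := loc (u - κ c) v) (g := ![u - κ c₀, v])
    (x := ![c - c₀, 0]) (hasConst_loc _ _) (fun i => by
      fin_cases i
      · exact hc'.hasVal_left.of_sub.sub ((hasConst_loc _ _).val c₀)
      · exact hc'.hasVal_right) p
  exact ((hval p).div (hval q) hne').mem

theorem tendsto_excPt (n : ℕ) (c₀ : ℂ) : Tendsto (excPt n) cofinite (𝓝 (excPt n c₀)) := by
  have h := (AI_tower n).symm.tendsto_loc c₀
  simp only [loc_comm _ cy] at h
  exact h

/-- One point of the exceptional line seen in both of its affine charts. -/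
theorem loc_inv_coordinate {u v : FF} (h : AI u v) {c : ℂ} (hc : c ≠ 0) :
    loc (u / v - κ c) v = loc u (v / u - κ c⁻¹) := by
  have hu := h.left_ne_zero
  have hv := h.right_ne_zero
  have h1 : AI (u / v - κ c) v := (h.symm.div_sub c).symm
  have h2 := h.div_sub c⁻¹
  have e1 := h1.hasVal_left.of_sub
  have e2 := h2.hasVal_right.of_sub
  refine loc_eq ?_ (HasVal.sub_const ?_) (HasVal.sub_const ?_) ?_
  · exact (e1.mul h1.hasVal_right).congr (by field_simp) (by simp)
  · exact (e1.inv hc).congr (by rw [inv_div]) rfl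
  · exact (e2.inv (inv_ne_zero hc)).congr (by rw [inv_div]) (by rw [inv_inv])
  · exact (e2.mul h2.hasVal_left).congr (by field_simp) (by simp)

/-- The points of an exceptional curve tend to its point at infinity. -/
theorem AI.tendsto_infinity {u v : FF} (h : AI u v) :
    Tendsto (fun c : ℂ => loc u (v / u - κ c⁻¹)) cofinite (𝓝 (loc v (u / v))) := by
  have h1 := h.symm.div.symm.tendsto_loc 0
  rw [map_zero, sub_zero, loc_comm (u / v)] at h1
  refine h1.congr' ?_
  filter_upwards [(Set.finite_singleton (0 : ℂ)).compl_mem_cofinite] with c hc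
  exact loc_inv_coordinate h hc

theorem tendsto_excInf (n : ℕ) :
    Tendsto (fun c => excPt (n + 1) c⁻¹) cofinite (𝓝 (excInf n)) := by
  have := (AI_tower n).tendsto_infinity
  rwa [div_tower, tower_div] at this

theorem tendsto_conPt (c₀ : ℂ) : Tendsto conPt cofinite (𝓝 (conPt c₀)) := by
  have h := (AI_conPt 0).symm.tendsto_loc c₀
  simp only [map_zero, sub_zero, loc_comm _ (cy / (cw - cy ^ 2))] at h
  exact h

theorem tendsto_conInf : Tendsto (fun c => conPt c⁻¹) cofinite (𝓝 conInf) := by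
  have := AI_pointP_symm.tendsto_infinity
  rwa [div_div_div_cancel_right₀ cw_sub_ne_zero, div_div_div_cancel_right₀ cw_sub_ne_zero,
    div_one] at this

/-! ### Images of the curves under the involution -/

theorem map_invol_mem_closure {D : Set (LocalSubring FF)} {A : LocalSubring FF}
    {γ : ℂ → LocalSubring FF} (hγ : Tendsto γ cofinite (𝓝 A))
    (h : ∀ c, c ≠ 0 → (γ c).map invol ∈ D) : A.map invol ∈ closure D := by
  refine mem_closure_of_tendsto (((continuous_localSubring_map invol).tendsto A).comp hγ) ?_
  filter_upwards [(Set.finite_singleton (0 : ℂ)).compl_mem_cofinite] with c hc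
  exact h c hc

theorem excPt_map_invol {n : ℕ} {c : ℂ} (hn : n ≤ 4) (hc : c ≠ 0) :
    (excPt n c).map invol = excPt (4 - n) c⁻¹ :=
  map_invol_eq_of_le (excPt_mem hn (Or.inl hc)) (excPt_mem (by omega) (Or.inl (inv_ne_zero hc)))
    (excPt_map_le hn hc)

theorem conPt_map_invol {c : ℂ} (hc : c ≠ 0) : (conPt c).map invol = affPt c⁻¹ 0 :=
  map_invol_eq_of_le (conPt_mem c) (affPt_mem (inv_ne_zero hc)) (affPt_map_le_conPt hc)

theorem affPt_map_invol {a : ℂ} (ha : a ≠ 0) : (affPt a 0).map invol = conPt a⁻¹ :=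
  map_invol_eq_of_le (affPt_mem ha) (conPt_mem _) (conPt_map_le_affPt ha)

theorem excPt_mem_exceptional (n : ℕ) (c : ℂ) : excPt (n + 1) c ∈ exceptional (tower n) :=
  mem_exceptional_tower.2 (Or.inl ⟨c, rfl⟩)

/-- The involution maps the points of `a` into the strict transform of `b`. -/
def Carries (a b : Set (LocalSubring FF)) : Prop :=
  ∀ A ∈ a ∩ resolved, A.map invol ∈ closure (b ∩ resolved)

/-- The points with `c ≠ 0` are computed directly; the two others, `c = 0` and `c = ∞`, are limits
of these, and the involution is continuous. -/
theorem carries_exceptional_tower {n : ℕ} (hn : n ≤ 3) {D : Set (LocalSubring FF)}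
    (h : ∀ c, c ≠ 0 → excPt (3 - n) c ∈ D) : Carries (exceptional (tower n)) D := by
  have key : ∀ c, c ≠ 0 → (excPt (n + 1) c).map invol ∈ D ∩ resolved := fun c hc => by
    rw [excPt_map_invol (by omega) hc, show 4 - (n + 1) = 3 - n by omega]
    exact ⟨h _ (inv_ne_zero hc), excPt_mem (by omega) (Or.inl (inv_ne_zero hc))⟩
  rintro A ⟨hA, -⟩
  rcases mem_exceptional_tower.1 hA with ⟨c, rfl⟩ | rfl
  · exact map_invol_mem_closure (tendsto_excPt _ _) key
  · exact map_invol_mem_closure (tendsto_excInf _) fun c hc => key _ (inv_ne_zero hc)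

theorem mem_conicC_iff {A : LocalSubring FF} :
    A ∈ conicC ↔ (∃ a, A = affPt a 0) ∨ A = pointP := by
  have hh : (X 0 * X 2 + X 1 ^ 2 : Coord).IsHomogeneous 2 :=
    ((isHomogeneous_X _ _).mul (isHomogeneous_X _ _)).add ((isHomogeneous_X _ _).pow 2)
  rw [conicC, mem_planeCurve_iff hh]
  simp

theorem mem_lineΔ'_iff {A : LocalSubring FF} :
    A ∈ lineΔ' ↔ (∃ b, A = excPt 0 b) ∨ A = pointP := by
  rw [lineΔ', mem_planeCurve_iff (isHomogeneous_X _ _)]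
  simp [affPt_zero]

theorem mem_lineΔ''_iff {A : LocalSubring FF} :
    A ∈ lineΔ'' ↔ (∃ a, A = affPt a (a ^ 2)) ∨ A = delPt 0 := by
  rw [lineΔ'', mem_planeCurve_iff (isHomogeneous_X _ _)]
  simp [sub_eq_zero]

theorem carries_exceptional_pointP : Carries (exceptional pointP) conicC := by
  have key : ∀ c, c ≠ 0 → (conPt c).map invol ∈ conicC ∩ resolved := fun c hc => by
    rw [conPt_map_invol hc]
    exact ⟨mem_conicC_iff.2 (Or.inl ⟨_, rfl⟩), affPt_mem (inv_ne_zero hc)⟩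
  rintro A ⟨hA, -⟩
  rcases mem_exceptional_pointP.1 hA with ⟨c, rfl⟩ | rfl
  · exact map_invol_mem_closure (tendsto_conPt _) key
  · exact map_invol_mem_closure tendsto_conInf fun c hc => key _ (inv_ne_zero hc)

/-- The points `R` and `P` of the conic have been blown up, so only points at which the image is
known explicitly remain. -/
theorem carries_conicC : Carries conicC (exceptional pointP) := by
  rintro A ⟨hA, hA'⟩
  rcases mem_conicC_iff.1 hA with ⟨a, rfl⟩ | rfl
  · have ha : a ≠ 0 := by
      rintro rfl
      refine notMem_resolved_of_mem_baseList ?_ hA'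
      rw [affPt_zero, ← tower_eq]
      simp [baseList]
    rw [affPt_map_invol ha]
    exact subset_closure ⟨mem_exceptional_pointP.2 (Or.inl ⟨_, rfl⟩), conPt_mem _⟩
  · exact absurd hA' (notMem_resolved_of_mem_baseList (by simp [baseList]))

theorem carries_lineΔ' : Carries lineΔ' (exceptional (tower 3)) := by
  rintro A ⟨hA, hA'⟩
  rcases mem_lineΔ'_iff.1 hA with ⟨b, rfl⟩ | rfl
  · have hb : b ≠ 0 := by
      rintro rfl
      refine notMem_resolved_of_mem_baseList ?_ hA'
      rw [← tower_eq]
      simp [baseList]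
    rw [excPt_map_invol (by omega) hb]
    exact subset_closure ⟨excPt_mem_exceptional 3 _, excPt_mem le_rfl (Or.inr rfl)⟩
  · exact absurd hA' (notMem_resolved_of_mem_baseList (by simp [baseList]))

/-- Inclusions into closures in both directions suffice, because the map is continuous and is its
own inverse on `resolved`. -/
theorem map_invol_mem_closure_iff {a b : Set (LocalSubring FF)} (h : Carries a b)
    (h' : Carries b a) {A : LocalSubring FF} (hA : A ∈ resolved) :
    A ∈ closure (a ∩ resolved) ↔ A.map invol ∈ closure (b ∩ resolved) := by
  have key : ∀ {a b : Set (LocalSubring FF)}, Carries a b → ∀ {A : LocalSubring FF},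
      A ∈ closure (a ∩ resolved) → A.map invol ∈ closure (b ∩ resolved) := fun h A hA =>
    map_mem_closure (continuous_localSubring_map invol) hA h |> fun h1 => by
      rwa [closure_closure] at h1
  refine ⟨key h, fun hb => ?_⟩
  have := key h' hb
  rwa [map_invol_map_invol hA] at this

/-! ### The points of indeterminacy and the induced isomorphism -/

/-- Every other point of this exceptional curve survives to `resolved`, where the map is regular. -/
theorem indeterminacy_exceptional_tower {n : ℕ} (hn : n ≤ 2) :
    {A ∈ exceptional (tower n) | ¬ cubicMap.RegularAt plane A} = {tower (n + 1)} := by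
  ext A
  simp only [Set.mem_ofPred_eq, Set.mem_singleton_iff, regularAt_plane_iff]
  constructor
  · rintro ⟨hA, h⟩
    rcases mem_exceptional_tower.1 hA with ⟨c, rfl⟩ | rfl
    · by_contra hne
      refine h (exists_plane_map_invol_le (excPt_mem (by omega) (Or.inl ?_)))
      rintro rfl
      exact hne (tower_eq _).symm
    · exact absurd (exists_plane_map_invol_le (excInf_mem (by omega))) h
  · rintro rfl
    refine ⟨tower_eq (n + 1) ▸ excPt_mem_exceptional n 0, ?_⟩
    rintro ⟨B, hB, h⟩
    refine not_map_invol_le_tower isSurf_plane_invField (fun c _ => ?_)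
      (show n + 1 ≤ 3 by omega) hB h
    rw [← affPt_zero]
    exact affPt_mem_plane 0 c

/-- The points to which the line `y = 0` is contracted. -/
theorem image_invol_lineΔ' {n : ℕ} (hn : n ≤ 3) :
    {B | B ∈ stage n ∧ ∃ A ∈ lineΔ', B.map invol ≤ A} = {tower n} := by
  -- `excPt 0 b` is sent to the point `excPt 4 b⁻¹` of the last exceptional curve, which lies over
  -- `tower n`. Hence in `stage n` the line is contracted to `tower n`.
  have hle : ∀ b, b ≠ 0 → (tower n).map invol ≤ excPt 0 b := fun b hb => by
    have h1 := (map_le_map_iff invol).2 (tower_le_excPt (show n < 4 by omega) b⁻¹)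
    exact h1.trans (excPt_map_le (n := 0) (by omega) hb)
  ext B
  simp only [Set.mem_ofPred_eq, Set.mem_singleton_iff]
  constructor
  · rintro ⟨hB, A, hA, h⟩
    rcases mem_lineΔ'_iff.1 hA with ⟨b, rfl⟩ | rfl
    · by_cases hb : b = 0
      · rw [hb, ← tower_eq] at h
        exact absurd h (not_map_invol_le_tower (isSurf_stage n)
          (fun c hc => excPt_mem_stage (Nat.zero_le n) (Or.inl hc)) (by omega) hB)
      · exact (isSurf_stage n).image_unique hB (tower_mem_stage n) h (hle b hb)
    · exact absurd h (not_map_invol_le_pointP (isSurf_stage n)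
        (fun a ha => affPt_mem_stage ha n) hB)
  · rintro rfl
    exact ⟨tower_mem_stage n, excPt 0 1, mem_lineΔ'_iff.2 (Or.inl ⟨1, rfl⟩), hle 1 one_ne_zero⟩

theorem tower_notMem_stage (n : ℕ) : tower n ∉ stage (n + 1) := fun h => by
  have key : ∀ c, tower n = excPt (n + 1) c := fun c =>
    (isSurf_stage (n + 1)).eq_of_le h (excPt_mem_stage le_rfl (Or.inr rfl))
      (tower_le_excPt (Nat.lt_succ_self n) c)
  exact excPt_ne_excPt (n + 1) zero_ne_one ((key 0).symm.trans (key 1))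

/-! ### The tangent line of the conic at `R` -/

theorem AI_cy_tangent : AI cy (cw / cy - cy) := by
  have hy := cy_ne_zero
  refine AI_cy_cw.of_mem_adjoin (fun E h _ => h) fun E h h' => ?_
  have := E.mul_mem (E.add_mem h' h) h
  rwa [sub_add_cancel, div_mul_cancel₀ _ hy] at this

theorem tower_one_eq : tower 1 = loc cy (cw / cy - cy) := by
  have h1 := AI_tower 1
  have h2 := AI_cy_tangent
  rw [pow_one] at h1
  rw [tower, pow_one]
  refine loc_eq h1.hasVal_left ?_ h2.hasVal_left ?_
  · simpa using h1.hasVal_right.sub h1.hasVal_left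
  · simpa using h2.hasVal_right.add h2.hasVal_left

/-- With `tower_one_eq` this puts `tower 1` and the points of the line `z = 0` into one family along
`w/y - y = z/y = 0`, to which `AI.tendsto_loc` applies. -/
theorem affPt_sq_eq {a : ℂ} (ha : a ≠ 0) : affPt a (a ^ 2) = loc (cy - κ a) (cw / cy - cy) := by
  have hy := cy_ne_zero
  have h1 := affPt_val_cy a (a ^ 2)
  have h2 := affPt_val_cw a (a ^ 2)
  have h3 : AI (cy - κ a) (cw / cy - cy) := by simpa using AI_cy_tangent.sub_const a 0
  have h4 := h3.hasVal_left.of_sub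
  refine loc_eq h1.sub_const (((h2.div h1 ha).sub h1).congr rfl ?_) h4.sub_const
    (HasVal.sub_const (((h3.hasVal_right.mul h4).add (h4.pow 2)).congr ?_ (by simp)))
  · field_simp
    ring
  · field_simp
    ring

/-- The strict transform of the line `z = 0`, which is tangent to the conic `C` at `R`. -/
theorem exceptional_inter_strictTransform :
    exceptional (tower 0) ∩ strictTransform (stage 1) lineΔ'' = {tower 1} := by
  have hy := cy_ne_zero
  have hw := cw_ne_zero
  have hq := cw_sub_ne_zero
  ext A
  simp only [Set.mem_inter_iff, Set.mem_singleton_iff, strictTransform]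
  constructor
  · rintro ⟨hA, -, hcl⟩
    by_contra hne
    -- The function `y/z` is regular at each point of the exceptional curve other than `tower 1`,
    -- and at no point of the line `z = 0` apart from `R`; it thus defines an open set separating
    -- `A` from the line.
    have hreg : cy / (cw - cy ^ 2) ∈ A.toSubring := by
      rcases mem_exceptional_tower.1 hA with ⟨c, rfl⟩ | rfl
      · have hc : c ≠ 0 := by
          rintro rfl
          exact hne (tower_eq 1).symm
        have e1 := excPt_val_cy 1 c
        have e2 := excPt_val 1 c
        refine ((e1.1.one.div (e2.sub e1) (by simpa using hc)).congr ?_ rfl).mem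
        rw [pow_one, show cw / cy - cy = (cw - cy ^ 2) / cy by field_simp, one_div_div]
      · have e1 := excInf_val_right 0
        have e2 := excInf_val_cw 0
        refine ((e1.div (e1.1.one.sub ((e1.pow 2).mul e2)) (by simp)).congr ?_ rfl).mem
        rw [show 1 - (cy ^ (0 + 1) / cw) ^ 2 * cw = (cw - cy ^ 2) / cw by
          field_simp
          simp]
        field_simp
        simp
    obtain ⟨B, hB, hB', hB''⟩ := mem_closure_iff.1 hcl {B | cy / (cw - cy ^ 2) ∈ B.toSubring}
      (TopologicalSpace.isOpen_generateFrom_of_mem ⟨_, rfl⟩) hreg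
    change cy / (cw - cy ^ 2) ∈ B.toSubring at hB
    rcases mem_lineΔ''_iff.1 hB' with ⟨a, rfl⟩ | rfl
    · have ha : a ≠ 0 := by
        rintro rfl
        refine tower_notMem_stage 0 ?_
        rwa [zero_pow two_ne_zero, affPt_zero, ← tower_eq] at hB''
      have e1 := affPt_val_cy a (a ^ 2)
      have e2 := (affPt_val_cw a (a ^ 2)).sub (e1.pow 2)
      rw [sub_self] at e2
      have e3 := InMax.mul_left hB e2.inMax
      rw [div_mul_cancel₀ _ hq] at e3
      exact ha (e1.unique (InMax.hasVal e1.1 e3))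
    · have e3 := InMax.mul_left hB (delPt_val_right 0).inMax
      rw [show cy / (cw - cy ^ 2) * (cw / cy - cy) = 1 by field_simp] at e3
      exact not_inMax_one _ e3
  · rintro rfl
    refine ⟨tower_eq 1 ▸ excPt_mem_exceptional 0 0, tower_mem_stage 1, ?_⟩
    have hlim := AI_cy_tangent.tendsto_loc 0
    rw [map_zero, sub_zero, ← tower_one_eq] at hlim
    refine mem_closure_of_tendsto hlim ?_
    filter_upwards [(Set.finite_singleton (0 : ℂ)).compl_mem_cofinite] with c hc
    rw [← affPt_sq_eq hc]
    exact ⟨mem_lineΔ''_iff.2 (Or.inl ⟨c, rfl⟩), affPt_mem_stage hc 1⟩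

theorem map_invol_linHomeo_symm_mem {B : LocalSubring FF} (hB : B ∈ linMap '' resolved) :
    (linHomeo.symm B).map invol ∈ resolved := by
  obtain ⟨A, hA, rfl⟩ := hB
  change (linHomeo.symm (linHomeo A)).map invol ∈ resolved
  rw [Homeomorph.symm_apply_apply]
  exact map_invol_mem hA

/-- The isomorphism of the blown up planes which is induced by the cubic map. -/
def resolvedHomeo : resolved ≃ₜ (linMap '' resolved : Set (LocalSubring FF)) where
  toFun A := ⟨linMap (A.1.map invol), _, map_invol_mem A.2, rfl⟩
  invFun B := ⟨(linHomeo.symm B.1).map invol, map_invol_linHomeo_symm_mem B.2⟩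
  left_inv A := Subtype.ext (by
    change (linHomeo.symm (linHomeo (A.1.map invol))).map invol = A.1
    rw [Homeomorph.symm_apply_apply, map_invol_map_invol A.2])
  right_inv B := by
    obtain ⟨_, A, hA, rfl⟩ := B
    refine Subtype.ext ?_
    change linMap (((linHomeo.symm (linHomeo A)).map invol).map invol) = linMap A
    rw [Homeomorph.symm_apply_apply, map_invol_map_invol hA]
  continuous_toFun := (linHomeo.continuous.comp ((continuous_localSubring_map invol).comp
    continuous_subtype_val)).subtype_mk _
  continuous_invFun := ((continuous_localSubring_map invol).comp
    (linHomeo.symm.continuous.comp continuous_subtype_val)).subtype_mk fun B =>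
      map_invol_linHomeo_symm_mem B.2

theorem resolvedHomeo_coe (A : resolved) :
    (resolvedHomeo A : LocalSubring FF) = linMap ((A : LocalSubring FF).map invol) := rfl

theorem induces_resolvedHomeo : cubicMap.Induces resolvedHomeo := fun A => by
  rw [resolvedHomeo_coe, linMap, localSubring_map_map, ← invol, map_invol_map_invol A.2]

theorem carriesCurve_resolvedHomeo {a b : Set (LocalSubring FF)} (h : Carries a b)
    (h' : Carries b a) : CarriesCurve resolvedHomeo (strictTransform resolved a)
      (strictTransform (linMap '' resolved) (linMap '' b)) := fun A => by
  rw [resolvedHomeo_coe, linMap_mem_strictTransform_iff]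
  constructor
  · rintro ⟨-, hA⟩
    exact ⟨map_invol_mem A.2, (map_invol_mem_closure_iff h h' A.2).1 hA⟩
  · rintro ⟨-, hA⟩
    exact ⟨A.2, (map_invol_mem_closure_iff h h' A.2).2 hA⟩

theorem isPt_tower (n : ℕ) : IsPt invField (tower n) :=
  (isSurf_stage n).pts _ (tower_mem_stage n)

theorem isPt_pointP : IsPt invField pointP := isSurf_plane_invField.pts _ pointP_mem_plane

theorem baseList_linMap : baseList.map linMap =
    [pointQ, linMap (tower 1), linMap (tower 2), linMap (tower 3), pointR] := by
  simp only [baseList, List.map_cons, List.map_nil, linMap_tower_zero, linMap_pointP]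

theorem isMinimalDesingularization_cubicMap : cubicMap.IsMinimalDesingularization baseList :=
  BirMap.isMinimalDesingularization_of_forall_not_regularAt isSurf_plane_invField
    isPointList_baseList (fun _ hA => regularAt_plane_iff.2 (exists_plane_map_invol_le hA))
    fun A hA h => by
      obtain ⟨B, hB, hle⟩ := regularAt_plane_iff.1 h
      exact not_map_invol_le_of_mem_baseList hA hB hle

theorem isMinimalDesingularization_cubicMap_symm :
    cubicMap.symm.IsMinimalDesingularization (baseList.map linMap) := by
  have hBl := Bl_linMap isSurf_plane_invField isPointList_baseList
  rw [image_plane_linMap] at hBl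
  refine BirMap.isMinimalDesingularization_of_forall_not_regularAt isSurf_plane_invField
    hBl.1 ?_ ?_
  · rw [hBl.2]
    rintro _ ⟨A, hA, rfl⟩
    exact symm_regularAt_plane_iff.2 (exists_plane_map_invol_le hA)
  · intro A' hA' h
    obtain ⟨A, hA, rfl⟩ := List.mem_map.1 hA'
    obtain ⟨B, hB, hle⟩ := symm_regularAt_plane_iff.1 h
    exact not_map_invol_le_of_mem_baseList hA hB hle

theorem Bl_linMap_baseList : Bl plane (baseList.map linMap) = linMap '' resolved :=
  Bl_plane_linMap isPointList_baseList

theorem exists_isomorphism :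
    ∃ g : Bl plane baseList ≃ₜ Bl plane (baseList.map linMap), cubicMap.Induces g ∧
      ∀ a b, Carries a b → Carries b a → CarriesCurve g (strictTransform (Bl plane baseList) a)
        (strictTransform (Bl plane (baseList.map linMap)) (linMap '' b)) := by
  rw [Bl_linMap_baseList]
  exact ⟨resolvedHomeo, induces_resolvedHomeo, fun a b => carriesCurve_resolvedHomeo⟩

end Cremona

end

/-! ### Assembly of the proposition -/

open Cremona in
theorem proposition4p1 :
    ∃ S U Y T V Z : LocalSubring FF,
      -- `S`, `U`, `Y` are the points of indeterminacy of `f` on the exceptional curves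
      -- of `R`, `S`, `U`
      {A ∈ exceptional pointR | ¬ cubicMap.RegularAt plane A} = {S} ∧
      {A ∈ exceptional S | ¬ cubicMap.RegularAt plane A} = {U} ∧
      {A ∈ exceptional U | ¬ cubicMap.RegularAt plane A} = {Y} ∧
      -- `T` is the point where the exceptional curve of `Q` meets the line `Δ`
      exceptional pointQ ∩ strictTransform (Bl plane [pointQ]) lineΔ = {T} ∧
      -- `V`, `Z` are the points of the exceptional curves of `T`, `V` to which `f` blows down `Δ'`
      (V ∈ exceptional T ∧ cubicMap.image (Bl plane [pointQ, T]) lineΔ' = {V}) ∧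
      (Z ∈ exceptional V ∧ cubicMap.image (Bl plane [pointQ, T, V]) lineΔ' = {Z}) ∧
      -- the two point lists give the minimal desingularization
      cubicMap.IsMinimalDesingularization [pointR, S, U, Y, pointP] ∧
      cubicMap.symm.IsMinimalDesingularization [pointQ, T, V, Z, pointR] ∧
      -- the induced isomorphism, and how it permutes the curves
      ∃ g : Bl plane [pointR, S, U, Y, pointP] ≃ₜ Bl plane [pointQ, T, V, Z, pointR],
        cubicMap.Induces g ∧
        ∀ a b : Set (LocalSubring FF),
          (a, b) ∈ ({(conicC, exceptional pointR), (exceptional pointP, conicC'),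
            (exceptional S, exceptional T), (exceptional U, exceptional pointQ),
            (exceptional pointR, exceptional V), (lineΔ', exceptional Z),
            (exceptional Y, lineΔ'')} : Set (Set (LocalSubring FF) × Set (LocalSubring FF))) →
          CarriesCurve g (strictTransform (Bl plane [pointR, S, U, Y, pointP]) a)
            (strictTransform (Bl plane [pointQ, T, V, Z, pointR]) b) := by
  have hE : ∀ n, exceptional (linMap (tower n)) = linMap '' exceptional (tower n) := fun n =>
    exceptional_linMap (isPt_tower n)
  have hEQ : exceptional pointQ = linMap '' exceptional (tower 0) := by
    rw [← linMap_tower_zero, hE]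
  have hER : exceptional pointR = linMap '' exceptional pointP := by
    rw [← linMap_pointP, exceptional_linMap isPt_pointP]
  have hV : ∀ n, tower (n + 1) ∈ exceptional (tower n) := fun n =>
    tower_eq (n + 1) ▸ excPt_mem_exceptional n 0
  have hs1 : Bl plane [pointQ] = linMap '' stage 1 := by
    rw [← linMap_tower_zero]
    exact Bl_plane_linMap (l := [tower 0]) ⟨tower_mem_stage 0, trivial⟩
  have hs2 : Bl plane [pointQ, linMap (tower 1)] = linMap '' stage 2 := by
    rw [← linMap_tower_zero]
    exact Bl_plane_linMap (l := [tower 0, tower 1]) ⟨tower_mem_stage 0, tower_mem_stage 1, trivial⟩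
  have hs3 : Bl plane [pointQ, linMap (tower 1), linMap (tower 2)] = linMap '' stage 3 := by
    rw [← linMap_tower_zero]
    exact Bl_plane_linMap (l := [tower 0, tower 1, tower 2])
      ⟨tower_mem_stage 0, tower_mem_stage 1, tower_mem_stage 2, trivial⟩
  have hbase : [pointR, tower 1, tower 2, tower 3, pointP] = baseList := by
    rw [pointR_eq_tower, baseList]
  -- Both lists come from the same points on the conic: the second is the image of the first under
  -- the linear map.
  refine ⟨tower 1, tower 2, tower 3, linMap (tower 1), linMap (tower 2), linMap (tower 3),
    ?_, indeterminacy_exceptional_tower (by omega), indeterminacy_exceptional_tower (by omega),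
    ?_, ⟨?_, ?_⟩, ⟨?_, ?_⟩, ?_, ?_, ?_⟩
  · rw [pointR_eq_tower]
    exact indeterminacy_exceptional_tower (by omega)
  · rw [hEQ, hs1, ← image_lineΔ'', ← Set.image_singleton, ← exceptional_inter_strictTransform,
      Set.image_inter linMap_injective]
    congr 1
    ext A
    constructor
    · rintro ⟨⟨A, hA, rfl⟩, hcl⟩
      exact ⟨A, linMap_mem_strictTransform_iff.1 ⟨⟨A, hA, rfl⟩, hcl⟩, rfl⟩
    · rintro ⟨A, hA, rfl⟩
      exact linMap_mem_strictTransform_iff.2 hA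
  · rw [hE]
    exact ⟨_, hV 1, rfl⟩
  · rw [hs2, image_linMap, image_invol_lineΔ' (by omega), Set.image_singleton]
  · rw [hE]
    exact ⟨_, hV 2, rfl⟩
  · rw [hs3, image_linMap, image_invol_lineΔ' (by omega), Set.image_singleton]
  · rw [hbase]
    exact isMinimalDesingularization_cubicMap
  · rw [← baseList_linMap]
    exact isMinimalDesingularization_cubicMap_symm
  · rw [hbase, ← baseList_linMap]
    obtain ⟨g, hg, hcurve⟩ := exists_isomorphism
    refine ⟨g, hg, fun a b hab => ?_⟩
    -- The exceptional curve of `tower n` consists of points `excPt (n + 1) c`, so the symmetry `n ↔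
    -- 4 - n` of coordinates becomes `n ↔ 2 - n` for the centres. The curve of `tower 3` is left
    -- over and pairs with the line `y = 0`.
    have ht : ∀ n, n ≤ 2 → Carries (exceptional (tower n)) (exceptional (tower (2 - n))) :=
      fun n hn => carries_exceptional_tower (by omega) fun c _ => by
        rw [show 3 - n = 2 - n + 1 by omega]
        exact excPt_mem_exceptional _ c
    have hN : Carries (exceptional (tower 3)) lineΔ' := carries_exceptional_tower le_rfl fun c _ =>
      mem_lineΔ'_iff.2 (Or.inl ⟨c, rfl⟩)
    simp only [Set.mem_insert_iff, Set.mem_singleton_iff, Prod.mk.injEq] at hab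
    rcases hab with ⟨rfl, rfl⟩ | ⟨rfl, rfl⟩ | ⟨rfl, rfl⟩ | ⟨rfl, rfl⟩ | ⟨rfl, rfl⟩ | ⟨rfl, rfl⟩ |
      ⟨rfl, rfl⟩
    · rw [hER]
      exact hcurve _ _ carries_conicC carries_exceptional_pointP
    · rw [← image_conicC]
      exact hcurve _ _ carries_exceptional_pointP carries_conicC
    · rw [hE]
      exact hcurve _ _ (ht 1 (by omega)) (ht 1 (by omega))
    · rw [hEQ]
      exact hcurve _ _ (ht 2 (by omega)) (ht 0 (by omega))
    · rw [hE, pointR_eq_tower]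
      exact hcurve _ _ (ht 0 (by omega)) (ht 2 (by omega))
    · rw [hE]
      exact hcurve _ _ carries_lineΔ' hN
    · rw [← image_lineΔ']
      exact hcurve _ _ hN carries_lineΔ'
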